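/- **Conventions.** Fix a discrete group $G$. C*-algebras are $\mathbb Z_2$-graded $G$-C*-algebras, and $*$-homomorphisms are grading preserving and $G$-equivariant. $\mathfrak m,\mathfrak n,\dots$ denote non-empty directed sets. $\Delta^{\mathfrak m}$ is the full simplicial complex on $\mathfrak m$ (also its set of simplices, i.e. non-empty finite subsets), and $|\Delta^{\mathfrak m}|$ is its geometric realization with the filter generated by the subcomplexes $|\Delta^{\mathfrak m\triangleright m}|$ spanned by the tails $\mathfrak m\triangleright m=\{k\in\mathfrak m\mid k\ge m\}$. For a space $X$ with a filter, $C_a(X;B)=C_b(X;B)/C_0(X;B)$, where $C_0(X;B)$ consists of the bounded continuous functions that converge to $0$ along the filter; $\mathfrak S^{\mathfrak m}B=C_a(|\Delta^{\mathfrak m}|;B)$. Two $*$-homomorphisms $\varphi_0,\varphi_1\colon A\to\mathfrak S^{\mathfrak m}B$ are $\mathfrak m$-homotopic if there is a $*$-homomorphism $A\to\mathfrak S^{\mathfrak m}(C([0,1];B))$ which evaluates to $\varphi_i$ at $i=0,1$; $[[A,B]]_{\mathfrak m}$ is the set of homotopy classes. A map $\alpha\colon\mathfrak m'\to\mathfrak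 m$ is called cofinal if for each $m\in\mathfrak m$ there is $m'\in\mathfrak m'$ with $\alpha(k)\ge m$ for all $k\ge m'$; its affine linear extension $|\alpha|$ then induces $\alpha^*\colon[[A,B]]_{\mathfrak m}\to[[A,B]]_{\mathfrak m'}$, and $[[A,B]]$ is the direct limit of the sets $[[A,B]]_{\mathfrak m}$ along these maps. Let $\mathfrak m\sharp\mathfrak n=\mathfrak m\times\mathfrak n^{\Delta^{\mathfrak m}}$ with the product order, and let $\mu\colon\mathfrak m\sharp\mathfrak n\to\mathfrak m$ be the projection. Choose $\vartheta\colon\Delta^{\mathfrak m\sharp\mathfrak n}\to\mathfrak n$ with $\vartheta(\varsigma)\le\vartheta(\sigma)$ for $\varsigma\subset\sigma$ and $\vartheta(\sigma)\ge\xi(\mu(\sigma))$ for all $(m,\xi)\in\sigma$. Let $X_\vartheta=\bigcup_\sigma|\Delta^\sigma|\times|\Delta^{\mathfrak n\triangleright\vartheta(\sigma)}|$ (a CW complex, with the filter generated by the sets $X_\vartheta\cap(|\Delta^{(\mathfrak m\sharp\mathfrak n)\triangleright k}|\times|\Delta^{\mathfrak n}|)$), let $I\colon|\Delta^{\mathfrak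 m\sharp\mathfrak n}|\to X_\vartheta$ be a homotopy inverse of the projection $X_\vartheta\to|\Delta^{\mathfrak m\sharp\mathfrak n}|$ (with respect to continuous filter-proper maps and homotopies), and put $\Theta=(|\mu|\times\mathrm{id})\circ I\colon|\Delta^{\mathfrak m\sharp\mathfrak n}|\to|\Delta^{\mathfrak m}|\times|\Delta^{\mathfrak n}|$. Pullback along $\Theta$ induces $\Theta^*\colon\mathfrak S^{\mathfrak m}\mathfrak S^{\mathfrak n}C\to\mathfrak S^{\mathfrak m\sharp\mathfrak n}C$, and the composition product is $$[[A,B]]_{\mathfrak m}\times[[B,C]]_{\mathfrak n}\to[[A,C]]_{\mathfrak m\sharp\mathfrak n},\qquad([[\varphi]],[[\psi]])\mapsto[[\psi]]\circ[[\varphi]]=[[\Theta^*\circ\mathfrak S^{\mathfrak m}(\psi)\circ\varphi]].$$ **Theorem.** Choices of $(\vartheta,I)$ as above exist and the composition product does not depend on them. It passes to the direct limits: there is a unique map $[[A,B]]\times[[B,C]]\to[[A,C]]$ which sends the images of $x\in[[A,B]]_{\mathfrak m}$ and $y\in[[B,C]]_{\mathfrak n}$ to the image of $y\circ x\in[[A,C]]_{\mathfrak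 m\sharp\mathfrak n}$, for all $\mathfrak m,\mathfrak n,x,y$. More precisely: 1. If $\beta\colon\mathfrak n'\to\mathfrak n$ is cofinal, then $\mathfrak m\sharp\beta\colon\mathfrak m\sharp\mathfrak n'\to\mathfrak m\sharp\mathfrak n$, $(m,\xi)\mapsto(m,\beta\circ\xi)$, is cofinal, and $(\mathfrak m\sharp\beta)^*(y\circ x)=(\beta^*y)\circ x$ for all $x\in[[A,B]]_{\mathfrak m}$ and $y\in[[B,C]]_{\mathfrak n}$. 2. If $\alpha\colon\mathfrak m'\to\mathfrak m$ is cofinal, then $\mathfrak k=\mathfrak m'\times\mathfrak n^{\Delta^{\mathfrak m'}}\times\mathfrak n^{\Delta^{\mathfrak m}}$ with the product order is directed, the maps $\gamma\colon\mathfrak k\to\mathfrak m'\sharp\mathfrak n$, $(m,\xi,\zeta)\mapsto(m,\xi)$, and $\delta\colon\mathfrak k\to\mathfrak m\sharp\mathfrak n$, $(m,\xi,\zeta)\mapsto(\alpha(m),\zeta)$, are cofinal, and $\delta^*(y\circ x)=\gamma^*(y\circ\alpha^*x)$ for all $x\in[[A,B]]_{\mathfrak m}$ and $y\in[[B,C]]_{\mathfrak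 n}$. -/

import Mathlib

open Filter Topology
open scoped BoundedContinuousFunction

universe u v

namespace Simpltotic

noncomputable section

/-! ### A continuous bounded section of a quotient map of Banach spaces -/

theorem exists_continuous_section {E F : Type*} [NormedAddCommGroup E] [NormedSpace ℝ E]
    [CompleteSpace E] [NormedAddCommGroup F] [NormedSpace ℝ F] (π : E →L[ℝ] F)
    (hπ : ∀ (q : F) (r : ℝ), ‖q‖ < r → ∃ v, π v = q ∧ ‖v‖ < r) :
    ∃ s : C(F, E), (∀ q, π (s q) = q) ∧ ∀ q, ‖s q‖ ≤ ‖q‖ + 3 := by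
  have base : ∃ s : C(F, E), ∀ q, s q ∈ Metric.ball (0 : E) (‖q‖ + 1) ∩ π ⁻¹' Metric.ball q 1 := by
    refine exists_continuous_forall_mem_convex_of_local_const
      (fun q => (convex_ball _ _).inter ((convex_ball q 1).linear_preimage π.toLinearMap)) ?_
    intro q
    obtain ⟨v, hv, hv'⟩ := hπ q (‖q‖ + 1) (by linarith)
    refine ⟨v, ?_⟩
    have h1 : ∀ᶠ y in 𝓝 q, ‖v‖ < ‖y‖ + 1 :=
      (continuous_norm.add continuous_const).continuousAt.eventually_const_lt hv'
    filter_upwards [h1, Metric.ball_mem_nhds q one_pos] with y hy hy'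
    refine ⟨by simpa using hy, ?_⟩
    simpa [hv, dist_comm] using hy'
  have step : ∀ (δ : ℝ) (s : C(F, E)), (∀ q, ‖q - π (s q)‖ < δ) →
      ∃ s' : C(F, E), (∀ q, ‖q - π (s' q)‖ < δ / 2) ∧ ∀ q, ‖s' q - s q‖ < δ := by
    intro δ s hs
    have hδ : 0 < δ := (norm_nonneg _).trans_lt (hs 0)
    have : ∃ c : C(F, E), ∀ q, c q ∈ Metric.ball (0 : E) δ ∩
        π ⁻¹' Metric.ball (q - π (s q)) (δ / 2) := by
      refine exists_continuous_forall_mem_convex_of_local_const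
        (fun q => (convex_ball _ _).inter ((convex_ball _ _).linear_preimage π.toLinearMap)) ?_
      intro q
      obtain ⟨v, hv, hv'⟩ := hπ _ _ (hs q)
      refine ⟨v, ?_⟩
      have hc : Continuous fun y => dist (π v) (y - π (s y)) := by fun_prop
      have h1 : ∀ᶠ y in 𝓝 q, dist (π v) (y - π (s y)) < δ / 2 :=
        hc.continuousAt.eventually_lt_const (by simp [hv]; positivity)
      filter_upwards [h1] with y hy
      exact ⟨by simpa using hv', hy⟩
    obtain ⟨c, hc⟩ := this
    refine ⟨s + c, fun q => ?_, fun q => ?_⟩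
    · have := (hc q).2
      simp only [Set.mem_preimage, Metric.mem_ball, dist_eq_norm] at this
      have e : q - π ((s + c) q) = -(π (c q) - (q - π (s q))) := by
        rw [ContinuousMap.add_apply, map_add]; abel
      rw [e, norm_neg]
      exact this
    · simpa using (hc q).1
  obtain ⟨s0, hs0⟩ := base
  choose! nxt hn1 hn2 using step
  let s : ℕ → C(F, E) := fun k => Nat.rec s0 (fun k t => nxt ((1 / 2 : ℝ) ^ k) t) k
  have hs : ∀ k q, ‖q - π (s k q)‖ < (1 / 2 : ℝ) ^ k := by
    intro k
    induction k with
    | zero =>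
      intro q
      have := (hs0 q).2
      simpa [s, dist_eq_norm, norm_sub_rev] using this
    | succ k ih =>
      intro q
      have := hn1 _ _ ih q
      rw [pow_succ]
      simpa [s, div_eq_mul_inv] using this
  have hd : ∀ q k, dist (s k q) (s (k + 1) q) ≤ 1 * (1 / 2 : ℝ) ^ k := by
    intro q k
    rw [dist_comm, dist_eq_norm, one_mul]
    exact (hn2 _ _ (hs k) q).le
  have hlim : ∀ q, ∃ a, Tendsto (fun k => s k q) atTop (𝓝 a) := fun q =>
    cauchySeq_tendsto_of_complete (cauchySeq_of_le_geometric _ _ (by norm_num) (hd q))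
  choose a ha using hlim
  have hdist : ∀ k q, dist (s k q) (a q) ≤ 1 * (1 / 2 : ℝ) ^ k / (1 - 1 / 2) := fun k q =>
    dist_le_of_le_geometric_of_tendsto _ _ (by norm_num) (hd q) (ha q) k
  have hunif : TendstoUniformly (fun k q => s k q) a atTop := by
    rw [Metric.tendstoUniformly_iff]
    intro ε hε
    have h0 : Tendsto (fun k : ℕ => 1 * (1 / 2 : ℝ) ^ k / (1 - 1 / 2)) atTop (𝓝 0) := by
      have := (tendsto_pow_atTop_nhds_zero_of_lt_one (r := (1 / 2 : ℝ)) (by norm_num)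
        (by norm_num)).const_mul 1 |>.div_const (1 - 1 / 2)
      simpa using this
    filter_upwards [h0.eventually_lt_const hε] with k hk q
    rw [dist_comm]
    exact (hdist k q).trans_lt hk
  have hcont : Continuous a := hunif.continuous (Frequently.of_forall fun k => (s k).continuous)
  refine ⟨⟨a, hcont⟩, fun q => ?_, fun q => ?_⟩
  · have h1 : Tendsto (fun k => q - π (s k q)) atTop (𝓝 (q - π (a q))) :=
      tendsto_const_nhds.sub ((π.continuous.tendsto _).comp (ha q))
    have h2 : Tendsto (fun k => q - π (s k q)) atTop (𝓝 0) :=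
      squeeze_zero_norm (fun k => (hs k q).le)
        (tendsto_pow_atTop_nhds_zero_of_lt_one (by norm_num) (by norm_num))
    exact (sub_eq_zero.1 (tendsto_nhds_unique h1 h2)).symm
  · have h1 : ‖s 0 q‖ < ‖q‖ + 1 := by simpa [s] using (hs0 q).1
    have h2 := hdist 0 q
    have h3 : ‖a q‖ ≤ ‖s 0 q‖ + dist (s 0 q) (a q) := by
      rw [dist_comm, dist_eq_norm]
      calc ‖a q‖ = ‖s 0 q + (a q - s 0 q)‖ := by simp
        _ ≤ _ := norm_add_le _ _
    simp only [ContinuousMap.coe_mk]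
    norm_num at h2
    linarith

/-! ### Graded `G`-C*-algebras and their homomorphisms -/

/-- A `ℤ/2`-grading (given by the grading automorphism) and an action of the discrete group `G` by
grading preserving automorphisms on a (not necessarily unital) C*-algebra `A`. -/
class GradedGAlg (G : Type v) [Group G] (A : Type u) [NonUnitalCStarAlgebra A] where
  act : G → (A →⋆ₙₐ[ℂ] A)
  act_one : ∀ a, act 1 a = a
  act_mul : ∀ g h a, act (g * h) a = act g (act h a)
  grading : A →⋆ₙₐ[ℂ] A
  grading_grading : ∀ a, grading (grading a) = a
  act_grading : ∀ g a, act g (grading a) = grading (act g a)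

/-- Grading preserving, `G`-equivariant `*`-homomorphisms. -/
structure GHom (G : Type v) [Group G] (A B : Type*) [NonUnitalCStarAlgebra A] [GradedGAlg G A]
    [NonUnitalCStarAlgebra B] [GradedGAlg G B] extends A →⋆ₙₐ[ℂ] B where
  map_act : ∀ (g : G) (a : A), toFun (GradedGAlg.act g a) = GradedGAlg.act g (toFun a)
  map_grading : ∀ a, toFun (GradedGAlg.grading G a) = GradedGAlg.grading G (toFun a)

section Hom

variable {G : Type v} [Group G]
variable {A B C D : Type*} [NonUnitalCStarAlgebra A] [GradedGAlg G A]
  [NonUnitalCStarAlgebra B] [GradedGAlg G B] [NonUnitalCStarAlgebra C] [GradedGAlg G C]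
  [NonUnitalCStarAlgebra D] [GradedGAlg G D]

instance : CoeFun (GHom G A B) (fun _ => A → B) := ⟨fun φ => φ.toNonUnitalStarAlgHom⟩

theorem GHom.ext {φ ψ : GHom G A B} (h : ∀ a, φ a = ψ a) : φ = ψ := by
  obtain ⟨φ, _, _⟩ := φ
  obtain ⟨ψ, _, _⟩ := ψ
  have : φ = ψ := NonUnitalStarAlgHom.ext h
  subst this
  rfl

theorem GHom.apply_act (φ : GHom G A B) (g : G) (a : A) :
    φ (GradedGAlg.act g a) = GradedGAlg.act g (φ a) := φ.map_act g a

theorem GHom.apply_grading (φ : GHom G A B) (a : A) :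
    φ (GradedGAlg.grading G a) = GradedGAlg.grading G (φ a) := φ.map_grading a

/-- Composition of homomorphisms. -/
def GHom.comp (ψ : GHom G B C) (φ : GHom G A B) : GHom G A C where
  toNonUnitalStarAlgHom := ψ.toNonUnitalStarAlgHom.comp φ.toNonUnitalStarAlgHom
  map_act g a := by
    change ψ (φ _) = GradedGAlg.act g (ψ (φ a))
    rw [φ.apply_act, ψ.apply_act]
  map_grading a := by
    change ψ (φ _) = GradedGAlg.grading G (ψ (φ a))
    rw [φ.apply_grading, ψ.apply_grading]

@[simp] theorem GHom.comp_apply (ψ : GHom G B C) (φ : GHom G A B) (a : A) :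
    ψ.comp φ a = ψ (φ a) := rfl

/-- Factoring a homomorphism `ψ` through a surjective homomorphism `q` with `ker q ⊆ ker ψ`. -/
def GHom.descend (q : GHom G A B) (hq : Function.Surjective q) (ψ : GHom G A C)
    (h : ∀ a, q a = 0 → ψ a = 0) : GHom G B C :=
  have key : ∀ a b, q (Function.surjInv hq b) = q a → ψ (Function.surjInv hq b) = ψ a := by
    intro a b hab
    have := h (Function.surjInv hq b - a) (by rw [map_sub, hab, sub_self])
    rwa [map_sub, sub_eq_zero] at this
  have hs : ∀ b, q (Function.surjInv hq b) = b := Function.surjInv_eq hq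
  { toFun := fun b => ψ (Function.surjInv hq b)
    map_smul' := fun c b => by
      rw [key (c • Function.surjInv hq b) _ (by simp [hs]), map_smul]; rfl
    map_zero' := by rw [key 0 _ (by simp [hs]), map_zero]
    map_add' := fun b b' => by
      rw [key (Function.surjInv hq b + Function.surjInv hq b') _ (by simp [hs]), map_add]
    map_mul' := fun b b' => by
      rw [key (Function.surjInv hq b * Function.surjInv hq b') _ (by simp [hs]), map_mul]
    map_star' := fun b => by
      rw [key (star (Function.surjInv hq b)) _ (by simp [hs, map_star]), map_star]
    map_act := fun g b => by
      rw [← ψ.apply_act]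
      exact key _ _ (by simp [hs, q.apply_act])
    map_grading := fun b => by
      rw [← ψ.apply_grading]
      exact key _ _ (by simp [hs, q.apply_grading]) }

theorem GHom.descend_apply (q : GHom G A B) (hq : Function.Surjective q) (ψ : GHom G A C)
    (h : ∀ a, q a = 0 → ψ a = 0) (a : A) : GHom.descend q hq ψ h (q a) = ψ a := by
  have := h (Function.surjInv hq (q a) - a) (by rw [map_sub, Function.surjInv_eq hq, sub_self])
  rwa [map_sub, sub_eq_zero] at this

theorem GHom.continuous (φ : GHom G A B) : Continuous φ :=
  AddMonoidHomClass.continuous_of_bound φ.toNonUnitalStarAlgHom 1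
    (fun a => by simpa using NonUnitalStarAlgHom.norm_apply_le φ.toNonUnitalStarAlgHom a)

theorem GHom.norm_le (φ : GHom G A B) (a : A) : ‖φ a‖ ≤ ‖a‖ :=
  NonUnitalStarAlgHom.norm_apply_le φ.toNonUnitalStarAlgHom a

end Hom

/-! ### Bounded continuous functions -/

section Cb

variable (X : Type*) [TopologicalSpace X]

/-- Postcomposition of bounded continuous functions with a `*`-homomorphism. -/
def cbMapAlg {A B : Type*} [NonUnitalCStarAlgebra A] [NonUnitalCStarAlgebra B]
    (φ : A →⋆ₙₐ[ℂ] B) : (X →ᵇ A) →⋆ₙₐ[ℂ] (X →ᵇ B) where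
  toFun f := BoundedContinuousFunction.ofNormedAddCommGroup (fun x => φ (f x))
    ((AddMonoidHomClass.continuous_of_bound φ 1
      (fun a => by simpa using NonUnitalStarAlgHom.norm_apply_le φ a)).comp f.continuous) ‖f‖
    (fun x => (NonUnitalStarAlgHom.norm_apply_le φ _).trans (f.norm_coe_le_norm x))
  map_smul' c f := by ext x; exact map_smul φ c (f x)
  map_zero' := by ext x; exact map_zero φ
  map_add' f g := by ext x; exact map_add φ (f x) (g x)
  map_mul' f g := by ext x; exact map_mul φ (f x) (g x)
  map_star' f := by ext x; exact map_star φ (f x)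

@[simp] theorem cbMapAlg_apply {A B : Type*} [NonUnitalCStarAlgebra A] [NonUnitalCStarAlgebra B]
    (φ : A →⋆ₙₐ[ℂ] B) (f : X →ᵇ A) (x : X) : cbMapAlg X φ f x = φ (f x) := rfl

variable {G : Type v} [Group G]

/-- `C_b(X; B)` with the action and the grading coming from `B` alone. -/
instance {B : Type*} [NonUnitalCStarAlgebra B] [GradedGAlg G B] : GradedGAlg G (X →ᵇ B) where
  act g := cbMapAlg X (GradedGAlg.act g)
  act_one f := by ext x; exact GradedGAlg.act_one (f x)
  act_mul g h f := by ext x; exact GradedGAlg.act_mul g h (f x)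
  grading := cbMapAlg X (GradedGAlg.grading G)
  grading_grading f := by ext x; exact GradedGAlg.grading_grading (f x)
  act_grading g f := by ext x; exact GradedGAlg.act_grading g (f x)

variable {A B C : Type*} [NonUnitalCStarAlgebra A] [GradedGAlg G A]
  [NonUnitalCStarAlgebra B] [GradedGAlg G B] [NonUnitalCStarAlgebra C] [GradedGAlg G C]

/-- The functor `C_b(X; -)` on morphisms. -/
def cbMap (φ : GHom G A B) : GHom G (X →ᵇ A) (X →ᵇ B) where
  toNonUnitalStarAlgHom := cbMapAlg X φ.toNonUnitalStarAlgHom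
  map_act g f := by ext x; exact φ.apply_act g (f x)
  map_grading f := by ext x; exact φ.apply_grading (f x)

@[simp] theorem cbMap_apply (φ : GHom G A B) (f : X →ᵇ A) (x : X) : cbMap X φ f x = φ (f x) := rfl

variable {X}

/-- Evaluation `C_b(X; B) → B` at a point. -/
def ev (x : X) : GHom G (X →ᵇ B) B where
  toFun f := f x
  map_smul' _ _ := rfl
  map_zero' := rfl
  map_add' _ _ := rfl
  map_mul' _ _ := rfl
  map_star' _ := rfl
  map_act _ _ := rfl
  map_grading _ := rfl

@[simp] theorem ev_apply (x : X) (f : X →ᵇ B) : ev (G := G) x f = f x := rfl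

/-- Pullback of bounded continuous functions along a continuous map. -/
def cbPull {X' : Type*} [TopologicalSpace X'] (p : C(X, X')) : GHom G (X' →ᵇ B) (X →ᵇ B) where
  toFun f := f.compContinuous p
  map_smul' _ _ := rfl
  map_zero' := rfl
  map_add' _ _ := rfl
  map_mul' _ _ := rfl
  map_star' _ := rfl
  map_act _ _ := rfl
  map_grading _ := rfl

@[simp] theorem cbPull_apply {X' : Type*} [TopologicalSpace X'] (p : C(X, X')) (f : X' →ᵇ B)
    (x : X) : cbPull (G := G) p f x = f (p x) := rfl

/-- The inclusion `C_b(X; C_b(Y; B)) ⊆ C_b(X × Y; B)`. -/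
def cbUncurry {Y : Type*} [TopologicalSpace Y] : GHom G (X →ᵇ (Y →ᵇ B)) ((X × Y) →ᵇ B) where
  toFun f := BoundedContinuousFunction.ofNormedAddCommGroup (fun p => f p.1 p.2)
    ((f.continuous.comp continuous_fst).eval continuous_snd) ‖f‖
    (fun p => ((f p.1).norm_coe_le_norm p.2).trans (f.norm_coe_le_norm p.1))
  map_smul' _ _ := rfl
  map_zero' := rfl
  map_add' _ _ := rfl
  map_mul' _ _ := rfl
  map_star' _ := rfl
  map_act _ _ := rfl
  map_grading _ := rfl

@[simp] theorem cbUncurry_apply {Y : Type*} [TopologicalSpace Y] (f : X →ᵇ (Y →ᵇ B)) (p : X × Y) :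
    cbUncurry (G := G) f p = f p.1 p.2 := rfl

/-- The canonical map `C([0,1]; C_b(Y; B)) → C_b(Y; C([0,1]; B))`. -/
def cbSwap {Y : Type*} [TopologicalSpace Y] : GHom G (unitInterval →ᵇ (Y →ᵇ B)) (Y →ᵇ (unitInterval →ᵇ B)) where
  toFun f := BoundedContinuousFunction.ofNormedAddCommGroup
    (fun y => (BoundedContinuousFunction.mkOfCompact ⟨fun t => f t y, by fun_prop⟩ :
      unitInterval →ᵇ B))
    (by
      have h : Continuous fun p : Y × unitInterval => f p.2 p.1 :=
        (f.continuous.comp continuous_snd).eval continuous_fst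
      exact (ContinuousMap.isometryEquivBoundedOfCompact unitInterval B).continuous.comp
        (ContinuousMap.curry ⟨_, h⟩).continuous) ‖f‖
    (fun y => (BoundedContinuousFunction.norm_le (norm_nonneg f)).2 fun t =>
      ((f t).norm_coe_le_norm y).trans (f.norm_coe_le_norm t))
  map_smul' _ _ := rfl
  map_zero' := rfl
  map_add' _ _ := rfl
  map_mul' _ _ := rfl
  map_star' _ := rfl
  map_act _ _ := rfl
  map_grading _ := rfl

@[simp] theorem cbSwap_apply {Y : Type*} [TopologicalSpace Y] (f : unitInterval →ᵇ (Y →ᵇ B)) (y : Y) (t : unitInterval) :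
    cbSwap (G := G) f y t = f t y := rfl

end Cb

/-! ### Generalized asymptotic algebras -/

/-- The filter that a space is equipped with as an integral part of its structure. -/
class FilterSpace (X : Type*) [TopologicalSpace X] where
  filt : Filter X

section Ca

variable (X : Type*) [TopologicalSpace X] [FilterSpace X] (B : Type*) [NonUnitalCStarAlgebra B]

/-- `C_0(X; B)`: the bounded continuous functions converging to zero along the filter of `X`. -/
def C0 : Submodule ℂ (X →ᵇ B) where
  carrier := {f | Tendsto f (FilterSpace.filt (X := X)) (𝓝 0)}
  add_mem' {f g} hf hg := by
    have := Tendsto.add hf hg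
    rw [add_zero] at this
    exact this
  zero_mem' := tendsto_const_nhds
  smul_mem' c f hf := by simpa using Tendsto.const_smul hf c

variable {X B}

theorem mem_C0 {f : X →ᵇ B} : f ∈ C0 X B ↔ Tendsto f (FilterSpace.filt (X := X)) (𝓝 0) := Iff.rfl

theorem mem_C0_iff {f : X →ᵇ B} :
    f ∈ C0 X B ↔ ∀ ε > 0, ∀ᶠ x in FilterSpace.filt (X := X), ‖f x‖ < ε := by
  rw [mem_C0, NormedAddGroup.tendsto_nhds_zero]

variable (X B) in
/-- `C_a(X; B) = C_b(X; B) / C_0(X; B)` with the quotient norm. -/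
def Ca : Type _ := (X →ᵇ B) ⧸ C0 X B

instance isClosed_C0 : IsClosed (C0 X B : Set (X →ᵇ B)) := by
  rw [← isSeqClosed_iff_isClosed]
  intro u f hu hf
  rw [SetLike.mem_coe, mem_C0_iff]
  intro ε hε
  obtain ⟨n, hn⟩ := ((Metric.tendsto_nhds.1 hf) (ε / 2) (half_pos hε)).exists
  filter_upwards [mem_C0_iff.1 (hu n) (ε / 2) (half_pos hε)] with x hx
  have h1 : ‖f x - u n x‖ < ε / 2 := by
    rw [← dist_eq_norm, dist_comm]
    exact (BoundedContinuousFunction.dist_coe_le_dist x).trans_lt hn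
  calc ‖f x‖ = ‖(f x - u n x) + u n x‖ := by simp
    _ ≤ _ := norm_add_le _ _
    _ < ε := by linarith

namespace Ca

instance : NormedAddCommGroup (Ca X B) := inferInstanceAs (NormedAddCommGroup ((X →ᵇ B) ⧸ C0 X B))
instance : NormedSpace ℂ (Ca X B) := inferInstanceAs (NormedSpace ℂ ((X →ᵇ B) ⧸ C0 X B))
instance : CompleteSpace (Ca X B) := inferInstanceAs (CompleteSpace ((X →ᵇ B) ⧸ C0 X B))

variable (X B) in
/-- The quotient map as a linear map. -/
def mkL : (X →ᵇ B) →ₗ[ℂ] Ca X B := (C0 X B).mkQ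

theorem mkL_surj : Function.Surjective (mkL X B) := Submodule.mkQ_surjective _

theorem mkL_eq_zero {f : X →ᵇ B} : mkL X B f = 0 ↔ f ∈ C0 X B := Submodule.Quotient.mk_eq_zero _

theorem mkL_eq {f g : X →ᵇ B} : mkL X B f = mkL X B g ↔ f - g ∈ C0 X B :=
  Submodule.Quotient.eq _

theorem norm_mkL_le (f : X →ᵇ B) : ‖mkL X B f‖ ≤ ‖f‖ := Submodule.Quotient.norm_mk_le _ f

theorem norm_lt_iff {x : Ca X B} {r : ℝ} : ‖x‖ < r ↔ ∃ f, mkL X B f = x ∧ ‖f‖ < r :=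
  QuotientAddGroup.norm_lt_iff (S := (C0 X B).toAddSubgroup)

theorem mul_mem_left {f g : X →ᵇ B} (hg : g ∈ C0 X B) : f * g ∈ C0 X B := by
  rw [mem_C0] at hg ⊢
  refine squeeze_zero_norm (a := fun x => ‖f‖ * ‖g x‖) (fun x => ?_)
    (by simpa using (hg.norm.const_mul ‖f‖))
  exact (norm_mul_le _ _).trans (by gcongr; exact f.norm_coe_le_norm x)

theorem mul_mem_right {f g : X →ᵇ B} (hf : f ∈ C0 X B) : f * g ∈ C0 X B := by
  rw [mem_C0] at hf ⊢
  refine squeeze_zero_norm (a := fun x => ‖f x‖ * ‖g‖) (fun x => ?_)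
    (by simpa using (hf.norm.mul_const ‖g‖))
  exact (norm_mul_le _ _).trans (by gcongr; exact g.norm_coe_le_norm x)

theorem star_mem {f : X →ᵇ B} (hf : f ∈ C0 X B) : star f ∈ C0 X B := by
  rw [mem_C0_iff] at hf ⊢
  simpa using hf

instance : Mul (Ca X B) where
  mul := Quotient.map₂ (· * ·) (by
    intro f f' hf g g' hg
    rw [← Quotient.eq_iff_equiv] at hf hg ⊢
    change mkL X B f = mkL X B f' at hf
    change mkL X B g = mkL X B g' at hg
    change mkL X B (f * g) = mkL X B (f' * g')
    rw [mkL_eq] at hf hg ⊢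
    have : f * g - f' * g' = f * (g - g') + (f - f') * g' := by noncomm_ring
    rw [this]
    exact add_mem (mul_mem_left hg) (mul_mem_right hf))

instance : Star (Ca X B) where
  star := Quotient.map star (by
    intro f f' hf
    rw [← Quotient.eq_iff_equiv] at hf ⊢
    change mkL X B f = mkL X B f' at hf
    change mkL X B (star f) = mkL X B (star f')
    rw [mkL_eq] at hf ⊢
    rw [← star_sub]
    exact star_mem hf)

theorem mkL_mul (f g : X →ᵇ B) : mkL X B (f * g) = mkL X B f * mkL X B g := rfl

theorem mkL_star (f : X →ᵇ B) : mkL X B (star f) = star (mkL X B f) := rfl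

instance : NonUnitalRing (Ca X B) where
  left_distrib a b c := by
    obtain ⟨a, rfl⟩ := mkL_surj a
    obtain ⟨b, rfl⟩ := mkL_surj b
    obtain ⟨c, rfl⟩ := mkL_surj c
    simp only [← mkL_mul, ← map_add, mul_add]
  right_distrib a b c := by
    obtain ⟨a, rfl⟩ := mkL_surj a
    obtain ⟨b, rfl⟩ := mkL_surj b
    obtain ⟨c, rfl⟩ := mkL_surj c
    simp only [← mkL_mul, ← map_add, add_mul]
  zero_mul a := by
    obtain ⟨a, rfl⟩ := mkL_surj a
    rw [← map_zero (mkL X B), ← mkL_mul, zero_mul]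
  mul_zero a := by
    obtain ⟨a, rfl⟩ := mkL_surj a
    rw [← map_zero (mkL X B), ← mkL_mul, mul_zero]
  mul_assoc a b c := by
    obtain ⟨a, rfl⟩ := mkL_surj a
    obtain ⟨b, rfl⟩ := mkL_surj b
    obtain ⟨c, rfl⟩ := mkL_surj c
    simp only [← mkL_mul, mul_assoc]

instance : NonUnitalNormedRing (Ca X B) where
  dist_eq := NormedAddGroup.dist_eq
  norm_mul_le a b := by
    refine le_of_forall_pos_lt_add fun ε hε => ?_
    have hc : Continuous fun t : ℝ => (‖a‖ + t) * (‖b‖ + t) := by fun_prop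
    have h0 : ∀ᶠ t in 𝓝 (0 : ℝ), (‖a‖ + t) * (‖b‖ + t) < ‖a‖ * ‖b‖ + ε :=
      hc.continuousAt.eventually_lt_const (by simpa using hε)
    obtain ⟨t, ht, ht0⟩ :=
      ((h0.filter_mono nhdsWithin_le_nhds).and (self_mem_nhdsWithin (s := Set.Ioi (0 : ℝ)))).exists
    obtain ⟨f, hf, hf'⟩ := norm_lt_iff.1 (lt_add_of_pos_right ‖a‖ ht0)
    obtain ⟨g, hg, hg'⟩ := norm_lt_iff.1 (lt_add_of_pos_right ‖b‖ ht0)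
    rw [← hf, ← hg, ← mkL_mul]
    rw [hf, hg]
    calc _ ≤ ‖f * g‖ := norm_mkL_le _
      _ ≤ ‖f‖ * ‖g‖ := norm_mul_le _ _
      _ ≤ (‖a‖ + t) * (‖b‖ + t) := by gcongr
      _ < _ := ht

instance : StarRing (Ca X B) where
  star_involutive a := by
    obtain ⟨a, rfl⟩ := mkL_surj a
    simp only [← mkL_star, star_star]
  star_mul a b := by
    obtain ⟨a, rfl⟩ := mkL_surj a
    obtain ⟨b, rfl⟩ := mkL_surj b
    simp only [← mkL_star, ← mkL_mul, star_mul]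
  star_add a b := by
    obtain ⟨a, rfl⟩ := mkL_surj a
    obtain ⟨b, rfl⟩ := mkL_surj b
    simp only [← mkL_star, ← map_add, star_add]

/-- A class in `C_a(X; B)` represented by a function which is eventually bounded by `r` has norm at
most `r`. -/
theorem norm_mkL_le_of_eventually {f : X →ᵇ B} {r : ℝ} (hr : 0 < r)
    (h : ∀ᶠ x in FilterSpace.filt (X := X), ‖f x‖ ≤ r) : ‖mkL X B f‖ ≤ r := by
  have hpos : ∀ x, 0 < max r ‖f x‖ := fun x => lt_max_of_lt_left hr
  let g : X →ᵇ B := BoundedContinuousFunction.ofNormedAddCommGroup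
    (fun x => ((r / max r ‖f x‖ : ℝ) : ℂ) • f x)
    ((Complex.continuous_ofReal.comp (continuous_const.div
      (continuous_const.max f.continuous.norm) fun x => (hpos x).ne')).smul f.continuous) r (by
      intro x
      rw [norm_smul, Complex.norm_real, Real.norm_of_nonneg (div_nonneg hr.le (hpos x).le),
        div_mul_eq_mul_div, div_le_iff₀ (hpos x)]
      gcongr
      exact le_max_right _ _)
  have hg : ‖g‖ ≤ r := BoundedContinuousFunction.norm_ofNormedAddCommGroup_le _ hr.le _
  have hfg : mkL X B f = mkL X B g := by
    rw [mkL_eq, mem_C0]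
    refine tendsto_const_nhds.congr' ?_
    filter_upwards [h] with x hx
    change 0 = f x - ((r / max r ‖f x‖ : ℝ) : ℂ) • f x
    rw [max_eq_left hx, div_self hr.ne']
    simp
  rw [hfg]
  exact (norm_mkL_le g).trans hg

theorem eventually_of_norm_lt {f : X →ᵇ B} {r : ℝ} (h : ‖mkL X B f‖ < r) :
    ∀ᶠ x in FilterSpace.filt (X := X), ‖f x‖ < r := by
  obtain ⟨g, hg, hgr⟩ := norm_lt_iff.1 h
  rw [mkL_eq] at hg
  filter_upwards [mem_C0_iff.1 hg (r - ‖g‖) (by linarith)] with x hx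
  have h1 := g.norm_coe_le_norm x
  have h2 : ‖f x‖ ≤ ‖(g - f) x‖ + ‖g x‖ := by
    calc ‖f x‖ = ‖g x - (g - f) x‖ := by simp
      _ ≤ _ := norm_sub_le _ _
      _ = _ := add_comm _ _
  linarith

instance : CStarRing (Ca X B) where
  norm_mul_self_le a := by
    obtain ⟨f, rfl⟩ := mkL_surj a
    rw [← mkL_star, ← mkL_mul]
    refine le_of_forall_pos_lt_add fun ε hε => ?_
    set r := ‖mkL X B (star f * f)‖ + ε / 2 with hr
    have hr0 : 0 < r := by positivity
    have h1 : ∀ᶠ x in FilterSpace.filt (X := X), ‖f x‖ ≤ Real.sqrt r := by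
      filter_upwards [eventually_of_norm_lt (f := star f * f) (r := r) (by linarith)] with x hx
      apply Real.le_sqrt_of_sq_le
      rw [sq, ← CStarRing.norm_star_mul_self]
      exact hx.le
    have h2 := norm_mkL_le_of_eventually (Real.sqrt_pos.2 hr0) h1
    calc _ ≤ Real.sqrt r * Real.sqrt r := by gcongr
      _ = r := Real.mul_self_sqrt hr0.le
      _ < _ := by linarith

instance : NonUnitalCStarAlgebra (Ca X B) where
  smul_assoc c a b := by
    obtain ⟨a, rfl⟩ := mkL_surj a
    obtain ⟨b, rfl⟩ := mkL_surj b
    simp only [smul_eq_mul, ← mkL_mul, ← map_smul, smul_mul_assoc]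
  smul_comm c a b := by
    obtain ⟨a, rfl⟩ := mkL_surj a
    obtain ⟨b, rfl⟩ := mkL_surj b
    simp only [smul_eq_mul, ← mkL_mul, ← map_smul, mul_smul_comm]
  star_smul c a := by
    obtain ⟨a, rfl⟩ := mkL_surj a
    simp only [← mkL_star, ← map_smul, star_smul]

variable (X B) in
/-- The quotient map as a `*`-homomorphism. -/
def mkAlg : (X →ᵇ B) →⋆ₙₐ[ℂ] Ca X B where
  toFun := mkL X B
  map_smul' := map_smul (mkL X B)
  map_zero' := map_zero (mkL X B)
  map_add' := map_add (mkL X B)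
  map_mul' := mkL_mul
  map_star' := mkL_star

theorem comp_mem {A : Type*} [NonUnitalCStarAlgebra A] (φ : A →⋆ₙₐ[ℂ] B) {f : X →ᵇ A}
    (hf : f ∈ C0 X A) : cbMapAlg X φ f ∈ C0 X B := by
  rw [mem_C0_iff] at hf ⊢
  intro ε hε
  filter_upwards [hf ε hε] with x hx
  exact (NonUnitalStarAlgHom.norm_apply_le φ _).trans_lt hx

/-- The map induced on `C_a(X; -)` by a `*`-homomorphism. -/
def mapAlg {A : Type*} [NonUnitalCStarAlgebra A] (φ : A →⋆ₙₐ[ℂ] B) : Ca X A →⋆ₙₐ[ℂ] Ca X B :=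
  let L : Ca X A →ₗ[ℂ] Ca X B := (C0 X A).mapQ (C0 X B)
    { toFun := cbMapAlg X φ
      map_add' := map_add _
      map_smul' := map_smul _ } (fun _ hf => comp_mem φ hf)
  have hL : ∀ f, L (mkL X A f) = mkL X B (cbMapAlg X φ f) := fun _ => rfl
  { toFun := L
    map_smul' := map_smul L
    map_zero' := map_zero L
    map_add' := map_add L
    map_mul' := by
      intro a b
      obtain ⟨a, rfl⟩ := mkL_surj a
      obtain ⟨b, rfl⟩ := mkL_surj b
      change L _ = L _ * L _
      simp only [← mkL_mul, hL, map_mul]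
    map_star' := by
      intro a
      obtain ⟨a, rfl⟩ := mkL_surj a
      change L _ = star (L _)
      simp only [← mkL_star, hL, map_star] }

theorem mapAlg_mk {A : Type*} [NonUnitalCStarAlgebra A] (φ : A →⋆ₙₐ[ℂ] B) (f : X →ᵇ A) :
    mapAlg φ (mkAlg X A f) = mkAlg X B (cbMapAlg X φ f) := rfl

theorem mkAlg_surj : Function.Surjective (mkAlg X B) := mkL_surj

variable {G : Type v} [Group G]

/-- `C_a(X; B)` with the action and the grading coming from `B` alone. -/
instance [GradedGAlg G B] : GradedGAlg G (Ca X B) where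
  act g := mapAlg (GradedGAlg.act g)
  act_one a := by
    obtain ⟨f, rfl⟩ := mkAlg_surj a
    rw [mapAlg_mk]
    exact congrArg _ (GradedGAlg.act_one (G := G) f)
  act_mul g h a := by
    obtain ⟨f, rfl⟩ := mkAlg_surj a
    simp only [mapAlg_mk]
    exact congrArg _ (GradedGAlg.act_mul g h f)
  grading := mapAlg (GradedGAlg.grading G)
  grading_grading a := by
    obtain ⟨f, rfl⟩ := mkAlg_surj a
    simp only [mapAlg_mk]
    exact congrArg _ (GradedGAlg.grading_grading (G := G) f)
  act_grading g a := by
    obtain ⟨f, rfl⟩ := mkAlg_surj a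
    simp only [mapAlg_mk]
    exact congrArg _ (GradedGAlg.act_grading g f)

variable (X) in
/-- The quotient map `C_b(X; B) → C_a(X; B)`. -/
def mk [GradedGAlg G B] : GHom G (X →ᵇ B) (Ca X B) where
  toNonUnitalStarAlgHom := mkAlg X B
  map_act _ _ := rfl
  map_grading _ := rfl

variable [GradedGAlg G B]

theorem mk_surj : Function.Surjective (mk (G := G) X (B := B)) := mkL_surj

theorem mk_eq_zero {f : X →ᵇ B} : mk (G := G) X f = 0 ↔ f ∈ C0 X B := mkL_eq_zero

theorem hom_ext {A : Type*} [NonUnitalCStarAlgebra A] [GradedGAlg G A] {φ ψ : GHom G (Ca X B) A}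
    (h : ∀ f, φ (mk (G := G) X f) = ψ (mk (G := G) X f)) : φ = ψ := by
  refine GHom.ext fun a => ?_
  obtain ⟨f, rfl⟩ := mk_surj (G := G) a
  exact h f

variable (X) in
/-- The functor `C_a(X; -)` on morphisms. -/
def map {A : Type*} [NonUnitalCStarAlgebra A] [GradedGAlg G A] (φ : GHom G A B) :
    GHom G (Ca X A) (Ca X B) :=
  GHom.descend (mk X) mk_surj ((mk X).comp (cbMap X φ)) fun _ hf =>
    (mk_eq_zero (G := G)).2
      (comp_mem φ.toNonUnitalStarAlgHom ((mk_eq_zero (G := G)).1 hf))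

@[simp] theorem map_mk {A : Type*} [NonUnitalCStarAlgebra A] [GradedGAlg G A] (φ : GHom G A B)
    (f : X →ᵇ A) : map X φ (mk (G := G) X f) = mk (G := G) X (cbMap X φ f) :=
  GHom.descend_apply _ _ _ _ f

/-- The pullback `C_a(X'; B) → C_a(X; B)` along a continuous filter-proper map `X → X'`. -/
def pull {X' : Type*} [TopologicalSpace X'] [FilterSpace X'] (p : C(X, X'))
    (hp : Tendsto p (FilterSpace.filt (X := X)) (FilterSpace.filt (X := X'))) :
    GHom G (Ca X' B) (Ca X B) :=
  GHom.descend (mk X') mk_surj ((mk X).comp (cbPull p)) fun f hf =>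
    have h : f ∈ C0 X' B := (mk_eq_zero (G := G)).1 hf
    (mk_eq_zero (G := G)).2 (show cbPull (G := G) p f ∈ C0 X B from (mem_C0.1 h).comp hp)

@[simp] theorem pull_mk {X' : Type*} [TopologicalSpace X'] [FilterSpace X'] (p : C(X, X'))
    (hp : Tendsto p (FilterSpace.filt (X := X)) (FilterSpace.filt (X := X'))) (f : X' →ᵇ B) :
    pull (G := G) p hp (mk (G := G) X' f) = mk (G := G) X (cbPull (G := G) p f) :=
  GHom.descend_apply _ _ _ _ f

end Ca

/-- Bounded continuous functions into a quotient `C_a(Y; B)` lift to bounded continuous functions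
into `C_b(Y; B)`. -/
theorem cbMap_mk_surj {G : Type v} [Group G] [GradedGAlg G B] (Z : Type*) [TopologicalSpace Z] :
    Function.Surjective (cbMap Z (Ca.mk (G := G) X (B := B))) := by
  let π : (X →ᵇ B) →L[ℝ] Ca X B := LinearMap.mkContinuous
    ((Ca.mkL X B).restrictScalars ℝ) 1 (fun f => by simpa using Ca.norm_mkL_le f)
  obtain ⟨s, hs, hs'⟩ := exists_continuous_section π (fun q r hq => Ca.norm_lt_iff.1 hq)
  intro g
  refine ⟨BoundedContinuousFunction.ofNormedAddCommGroup (fun z => s (g z))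
    (s.continuous.comp g.continuous) (‖g‖ + 3) (fun z => (hs' _).trans ?_), ?_⟩
  · gcongr
    exact g.norm_coe_le_norm z
  · ext z
    exact hs (g z)

end Ca

/-! ### Homotopies -/

section Homotopy

variable {G : Type v} [Group G] {X Y : Type*} [TopologicalSpace X] [FilterSpace X]
  [TopologicalSpace Y] [FilterSpace Y]
  {A B C : Type*} [NonUnitalCStarAlgebra A] [GradedGAlg G A]
  [NonUnitalCStarAlgebra B] [GradedGAlg G B] [NonUnitalCStarAlgebra C] [GradedGAlg G C]

/-- `C_a(X; -)`-homotopy of homomorphisms `A → C_a(X; B)`. Since `[0,1]` is compact, the C*-algebra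
`C([0,1]; B)` is `unitInterval →ᵇ B`. -/
def Homotopic (φ₀ φ₁ : GHom G A (Ca X B)) : Prop :=
  ∃ Φ : GHom G A (Ca X (unitInterval →ᵇ B)),
    (Ca.map X (ev (0 : unitInterval))).comp Φ = φ₀ ∧ (Ca.map X (ev (1 : unitInterval))).comp Φ = φ₁

variable (G X A B) in
/-- `⟦A, B⟧_X`: the set of `C_a(X; -)`-homotopy classes of homomorphisms `A → C_a(X; B)`. -/
def Cls : Type _ := Quot (Homotopic (G := G) (X := X) (A := A) (B := B))

/-- The class of a homomorphism. -/
def Cls.mk (φ : GHom G A (Ca X B)) : Cls G X A B := Quot.mk _ φ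

/-- Naturality of the pullback maps. -/
theorem Ca.map_comp_pull {X' : Type*} [TopologicalSpace X'] [FilterSpace X'] (p : C(X, X'))
    (hp : Tendsto p (FilterSpace.filt (X := X)) (FilterSpace.filt (X := X'))) (φ : GHom G B C) :
    (Ca.map X φ).comp (Ca.pull p hp) = (Ca.pull p hp).comp (Ca.map X' φ) := by
  refine Ca.hom_ext fun f => ?_
  simp only [GHom.comp_apply, Ca.pull_mk, Ca.map_mk]
  rfl

theorem GHom.comp_assoc {D : Type*} [NonUnitalCStarAlgebra D] [GradedGAlg G D]
    (χ : GHom G C D) (ψ : GHom G B C) (φ : GHom G A B) :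
    (χ.comp ψ).comp φ = χ.comp (ψ.comp φ) := rfl

/-- The map `⟦A, B⟧_{X'} → ⟦A, B⟧_X` induced by a continuous filter-proper map `X → X'`. -/
def Cls.pull {X' : Type*} [TopologicalSpace X'] [FilterSpace X'] (p : C(X, X'))
    (hp : Tendsto p (FilterSpace.filt (X := X)) (FilterSpace.filt (X := X'))) :
    Cls G X' A B → Cls G X A B :=
  Quot.map (fun φ => (Ca.pull p hp).comp φ) (by
    rintro φ₀ φ₁ ⟨Φ, rfl, rfl⟩
    refine ⟨(Ca.pull p hp).comp Φ, ?_, ?_⟩ <;>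
      rw [← GHom.comp_assoc, ← GHom.comp_assoc, Ca.map_comp_pull])

theorem cbSwap_mem {f : unitInterval →ᵇ (Y →ᵇ B)} (hf : ∀ t, f t ∈ C0 Y B) :
    cbSwap (G := G) f ∈ C0 Y (unitInterval →ᵇ B) := by
  rw [mem_C0_iff]
  intro ε hε
  have key : ∀ᶠ y in FilterSpace.filt (X := Y), ∀ t ∈ (Set.univ : Set unitInterval),
      ‖f t y‖ < ε / 2 := by
    refine isCompact_univ.induction_on (p := fun s => ∀ᶠ y in FilterSpace.filt (X := Y),
      ∀ t ∈ s, ‖f t y‖ < ε / 2) (by simp) ?_ ?_ ?_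
    · intro s s' hs h
      filter_upwards [h] with y hy t ht using hy t (hs ht)
    · intro s s' h h'
      filter_upwards [h, h'] with y hy hy' t ht
      exact ht.elim (hy t) (hy' t)
    · intro t _
      refine ⟨{t' | ‖f t' - f t‖ < ε / 4}, ?_, ?_⟩
      · refine mem_nhdsWithin_of_mem_nhds ?_
        have hc : Continuous fun t' => ‖f t' - f t‖ := by fun_prop
        exact hc.continuousAt.eventually_lt_const (by simpa using by positivity)
      · filter_upwards [mem_C0_iff.1 (hf t) (ε / 4) (by positivity)] with y hy t' ht'
        have h1 := (f t' - f t).norm_coe_le_norm y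
        have h2 : ‖f t' y‖ ≤ ‖(f t' - f t) y‖ + ‖f t y‖ := by
          calc ‖f t' y‖ = ‖(f t' - f t) y + f t y‖ := by simp
            _ ≤ _ := norm_add_le _ _
        change ‖f t' - f t‖ < ε / 4 at ht'
        linarith
  filter_upwards [key] with y hy
  refine lt_of_le_of_lt ((BoundedContinuousFunction.norm_le (half_pos hε).le).2 fun t => ?_)
    (half_lt_self hε)
  exact (hy t trivial).le

variable (G Y B) in
/-- The canonical map `C([0,1]; C_a(Y; B)) → C_a(Y; C([0,1]; B))`. -/
def caSwap : GHom G (unitInterval →ᵇ Ca Y B) (Ca Y (unitInterval →ᵇ B)) :=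
  GHom.descend (cbMap unitInterval (Ca.mk (G := G) Y)) (cbMap_mk_surj unitInterval)
    ((Ca.mk (G := G) Y).comp cbSwap) fun f hf => by
      refine (Ca.mk_eq_zero (G := G)).2 (cbSwap_mem (G := G) (f := f) fun t => ?_)
      exact (Ca.mk_eq_zero (G := G)).1 (congrArg (fun h : unitInterval →ᵇ Ca Y B => h t) hf)

theorem map_ev_caSwap (t : unitInterval) :
    (Ca.map Y (ev t)).comp (caSwap G Y B) = ev t := by
  refine GHom.ext fun a => ?_
  obtain ⟨f, rfl⟩ := cbMap_mk_surj (G := G) unitInterval a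
  have : caSwap G Y B (cbMap unitInterval (Ca.mk (G := G) Y) f) = Ca.mk (G := G) Y (cbSwap (G := G) f) :=
    GHom.descend_apply _ _ _ _ f
  rw [GHom.comp_apply, this, Ca.map_mk]
  rfl

theorem Ca.map_map (ψ : GHom G B C) (φ : GHom G A B) :
    Ca.map X (ψ.comp φ) = (Ca.map X ψ).comp (Ca.map X φ) := by
  refine Ca.hom_ext fun f => ?_
  simp only [GHom.comp_apply, Ca.map_mk]
  rfl

/-- Continuous filter-proper maps which are homotopic through a continuous filter-proper homotopy,
where `X × [0,1]` carries the filter generated by the sets `U × [0,1]`. -/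
def FilterHomotopic (p₀ p₁ : C(X, Y)) : Prop :=
  ∃ h : C(X × unitInterval, Y), (∀ x, h (x, 0) = p₀ x) ∧ (∀ x, h (x, 1) = p₁ x) ∧
    Tendsto h (comap Prod.fst (FilterSpace.filt (X := X))) (FilterSpace.filt (X := Y))

end Homotopy

/-! ### Full simplicial complexes on directed sets -/

/-- The set of simplices of the full simplicial complex with vertex set `S`. -/
def Simplex (S : Type u) : Type u := {σ : Finset S // σ.Nonempty}

open scoped Classical in
/-- The image of a simplex under a map of vertices. -/
def Simplex.map {S T : Type u} (f : S → T) (σ : Simplex S) : Simplex T :=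
  ⟨σ.1.image f, σ.2.image f⟩

/-- The geometric realization of the full simplicial complex with vertex set `S`: its points are the
formal finite convex combinations of elements of `S`. -/
def Realization (S : Type u) : Type u := Convexity.StdSimplex ℝ S

namespace Realization

variable {S T : Type u}

/-- The inclusion of a geometric simplex. -/
def faceIncl (σ : Finset S) (w : stdSimplex ℝ σ) : Realization S :=
  Convexity.StdSimplex.map (Subtype.val : σ → S)
    { weights := Finsupp.equivFunOnFinite.symm w.1
      nonneg := w.2.1
      total := by
        rw [Finsupp.sum_fintype _ _ (fun _ => rfl)]
        exact w.2.2 }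

/-- The weak topology with respect to the (Euclidean) geometric simplices. -/
instance : TopologicalSpace (Realization S) :=
  ⨆ σ : Finset S, TopologicalSpace.coinduced (faceIncl σ) inferInstance

/-- The subspace `|Δ^σ|` of `|Δ^S|`. -/
def face (σ : Finset S) : Set (Realization S) := {x | x.weights.support ⊆ σ}

/-- The subspace of all points whose vertices are at least `m`, i.e. the geometric realization
of the full simplicial complex on the tail starting at `m`. -/
def tail [Preorder S] (m : S) : Set (Realization S) := {x | ∀ s ∈ x.weights.support, m ≤ s}

/-- The filter on `|Δ^S|` generated by the tails. -/
instance [Preorder S] : FilterSpace (Realization S) where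
  filt := ⨅ m : S, 𝓟 (tail m)

theorem continuous_faceIncl (σ : Finset S) : Continuous (faceIncl σ) :=
  continuous_iff_coinduced_le.2 (le_iSup (fun σ : Finset S =>
    TopologicalSpace.coinduced (faceIncl σ) inferInstance) σ)

theorem continuous_iff {Z : Type*} [TopologicalSpace Z] {f : Realization S → Z} :
    Continuous f ↔ ∀ σ, Continuous (f ∘ faceIncl σ) := by
  rw [continuous_iSup_dom]
  exact forall_congr' fun σ => continuous_coinduced_dom

/-- The support of a point, as a simplex. -/
def supp (x : Realization S) : Simplex S := ⟨x.weights.support, x.support_weights_nonempty⟩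

theorem face_eq_range (σ : Finset S) : face σ = Set.range (faceIncl σ) := by
  classical
  ext x
  constructor
  · intro hx
    have hx' : x.weights.support ⊆ σ := hx
    refine ⟨⟨fun s => x.weights s, fun s => x.nonneg s, ?_⟩, ?_⟩
    · rw [← x.total, Finsupp.sum_of_support_subset _ hx' _ (fun _ _ => rfl)]
      exact Finset.sum_coe_sort σ (fun s => x.weights s)
    · refine Convexity.StdSimplex.ext (Finsupp.ext fun s => ?_)
      change Finsupp.mapDomain Subtype.val _ s = _
      by_cases hs : s ∈ σ
      · exact Finsupp.mapDomain_apply Subtype.val_injective _ (⟨s, hs⟩ : σ)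
      · rw [Finsupp.mapDomain_of_notMem_range _ _ (by simpa using hs)]
        by_contra h
        exact hs (hx' (Finsupp.mem_support_iff.2 (Ne.symm h)))
  · rintro ⟨w, rfl⟩ s hs
    have := Finsupp.mapDomain_support hs
    obtain ⟨t, -, rfl⟩ := Finset.mem_image.1 this
    exact t.2

theorem isCompact_face (σ : Finset S) : IsCompact (face σ) := by
  rw [face_eq_range]
  exact isCompact_range (continuous_faceIncl σ)

/-- The affine linear extension `|α|` of a map `α` of vertices. -/
def map (α : S → T) : C(Realization S, Realization T) where
  toFun := Convexity.StdSimplex.map α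
  continuous_toFun := by
    classical
    refine continuous_iff.2 fun σ => ?_
    let g : σ → (σ.image α) := fun s => ⟨α s, Finset.mem_image_of_mem α s.2⟩
    have : Convexity.StdSimplex.map α ∘ faceIncl σ = faceIncl (σ.image α) ∘ stdSimplex.map g := by
      funext w
      refine Convexity.StdSimplex.ext ?_
      change Finsupp.mapDomain α (Finsupp.mapDomain Subtype.val _) =
        Finsupp.mapDomain Subtype.val (Finsupp.equivFunOnFinite.symm
          (Finsupp.equivFunOnFinite (Finsupp.mapDomain g (Finsupp.equivFunOnFinite.symm w.1))))
      rw [Equiv.symm_apply_apply, ← Finsupp.mapDomain_comp, ← Finsupp.mapDomain_comp]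
      rfl
    exact this ▸ (continuous_faceIncl _).comp (stdSimplex.continuous_map g)

theorem support_map (α : S → T) (x : Realization S) {t : T} (ht : t ∈ (map α x).weights.support) :
    ∃ s ∈ x.weights.support, α s = t := by
  classical
  exact Finset.mem_image.1 (Finsupp.mapDomain_support ht)

theorem hasBasis_filt [Preorder S] [Nonempty S] [IsDirectedOrder S] :
    (FilterSpace.filt (X := Realization S)).HasBasis (fun _ : S => True) tail :=
  hasBasis_iInf_principal fun m n =>
    let ⟨k, hm, hn⟩ := exists_ge_ge m n
    ⟨k, fun _ hx s hs => hm.trans (hx s hs), fun _ hx s hs => hn.trans (hx s hs)⟩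

end Realization

/-- Cofinal maps `α : m → n`, in the sense that `α` is eventually above each element of `n`. -/
def Cofinal {m n : Type u} [Preorder m] [Preorder n] (α : m → n) : Prop :=
  ∀ j : n, ∃ i : m, ∀ k, i ≤ k → j ≤ α k

theorem Cofinal.tendsto {m n : Type u} [Preorder m] [Preorder n] {α : m → n} (hα : Cofinal α) :
    Tendsto (Realization.map α) (FilterSpace.filt (X := Realization m)) (FilterSpace.filt (X := Realization n)) := by
  refine tendsto_iInf.2 fun j => tendsto_principal.2 ?_
  obtain ⟨i, hi⟩ := hα j
  refine mem_of_superset (mem_iInf_of_mem i (mem_principal_self _)) fun x hx t ht => ?_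
  obtain ⟨s, hs, rfl⟩ := Realization.support_map α x ht
  exact hi s (hx s hs)

/-- The directed set `m ♯ n = m × n^{Δ^m}` with the canonical order. -/
abbrev Sharp (m n : Type u) : Type u := m × (Simplex m → n)

theorem directed_prod (m n : Type u) [Preorder m] [Preorder n] [IsDirectedOrder m]
    [IsDirectedOrder n] : IsDirectedOrder (m × n) where
  directed a b :=
    let ⟨c, h1, h2⟩ := exists_ge_ge a.1 b.1
    let ⟨d, h3, h4⟩ := exists_ge_ge a.2 b.2
    ⟨(c, d), ⟨h1, h3⟩, ⟨h2, h4⟩⟩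

theorem directed_pi (I n : Type u) [Preorder n] [IsDirectedOrder n] :
    IsDirectedOrder (I → n) where
  directed a b := by
    choose c h1 h2 using fun i => exists_ge_ge (a i) (b i)
    exact ⟨c, h1, h2⟩

/-! ### The space `X_θ` -/

/-- The union of the sets `|Δ^σ| × |Δ^{n ▷ θ(σ)}|` over all simplices `σ`. -/
def XSpace {k n : Type u} [Preorder n] (θ : Simplex k → n) : Type u :=
  {p : Realization k × Realization n // ∃ σ : Simplex k, p.1 ∈ Realization.face σ.1 ∧ p.2 ∈ Realization.tail (θ σ)}

namespace XSpace

variable {k n : Type u} [Preorder n] (θ : Simplex k → n)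

/-- The topology of `X_θ` as a CW complex: the weak topology with respect to its intersections with
the products of two geometric simplices. -/
instance : TopologicalSpace (XSpace θ) :=
  ⨆ c : Finset k × Finset n, TopologicalSpace.coinduced
    (Subtype.val : {p : XSpace θ // p.1.1 ∈ Realization.face c.1 ∧ p.1.2 ∈ Realization.face c.2} → XSpace θ)
    (TopologicalSpace.induced (fun p => p.1.1) inferInstance)

/-- The filter on `X_θ` generated by the sets `X_θ ∩ (|Δ^{k ▷ i}| × |Δ^n|)`. -/
instance [Preorder k] : FilterSpace (XSpace θ) where
  filt := ⨅ i : k, 𝓟 {p : XSpace θ | p.1.1 ∈ Realization.tail i}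

/-- The inclusion of `X_θ` into the product. -/
def incl : C(XSpace θ, Realization k × Realization n) where
  toFun := Subtype.val
  continuous_toFun := by
    refine continuous_iSup_dom.2 fun c => continuous_coinduced_dom.2 ?_
    exact continuous_induced_dom

/-- The projection `P_θ` onto the first component. -/
def proj : C(XSpace θ, Realization k) := ContinuousMap.fst.comp (incl θ)

end XSpace

theorem exists_tail_of_compact {m n : Type u} [Preorder n] [Nonempty n] [IsDirectedOrder n]
    {G : Type v} [Group G] {C : Type*} [NonUnitalCStarAlgebra C] [GradedGAlg G C] {K : Set (Realization m)} (hK : IsCompact K)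
    (f : Realization m →ᵇ (Realization n →ᵇ C)) {ε : ℝ} (hf : ∀ x ∈ K, ‖Ca.mk (G := G) (Realization n) (f x)‖ < ε) :
    ∃ j : n, ∀ x ∈ K, ∀ y ∈ Realization.tail j, ‖f x y‖ < ε := by
  refine hK.induction_on (p := fun s => ∃ j : n, ∀ x ∈ s, ∀ y ∈ Realization.tail j, ‖f x y‖ < ε)
    ⟨Classical.arbitrary n, by simp⟩ ?_ ?_ ?_
  · rintro s t hst ⟨j, hj⟩
    exact ⟨j, fun x hx => hj x (hst hx)⟩
  · rintro s t ⟨i, hi⟩ ⟨j, hj⟩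
    obtain ⟨l, hil, hjl⟩ := exists_ge_ge i j
    refine ⟨l, fun x hx y hy => ?_⟩
    rcases hx with hx | hx
    · exact hi x hx y fun s hs => hil.trans (hy s hs)
    · exact hj x hx y fun s hs => hjl.trans (hy s hs)
  · intro x hx
    obtain ⟨r, hr, hrε⟩ := exists_between (hf x hx)
    obtain ⟨j, -, hj⟩ := Realization.hasBasis_filt.eventually_iff.1 (Ca.eventually_of_norm_lt hr)
    refine ⟨{x' | ‖f x' - f x‖ < ε - r}, mem_nhdsWithin_of_mem_nhds ?_, j, fun x' hx' y hy => ?_⟩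
    · have hc : Continuous fun x' => ‖f x' - f x‖ := by fun_prop
      exact hc.continuousAt.eventually_lt_const (by simpa using hrε)
    · have h1 := (f x' - f x).norm_coe_le_norm y
      have h2 : ‖f x' y‖ ≤ ‖(f x' - f x) y‖ + ‖f x y‖ := by
        calc ‖f x' y‖ = ‖(f x' - f x) y + f x y‖ := by simp
          _ ≤ _ := norm_add_le _ _
      have h3 : ‖f x y‖ < r := hj hy
      change ‖f x' - f x‖ < ε - r at hx'
      linarith

variable {m n : Type u} [Preorder m] [Preorder n]

/-- The conditions on a choice of `θ : Δ^{m ♯ n} → n`: monotonicity, and `θ(σ) ≥ ξ(μ(σ))`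
for all `(i, ξ) ∈ σ`, where `μ` is the projection to `m`. -/
structure Admissible (θ : Simplex (Sharp m n) → n) : Prop where
  mono : ∀ ς σ : Simplex (Sharp m n), ς.1 ⊆ σ.1 → θ ς ≤ θ σ
  ge : ∀ σ : Simplex (Sharp m n), ∀ p ∈ σ.1, p.2 (σ.map Prod.fst) ≤ θ σ

/-- The map `|μ| × id : X_θ → |Δ^m| × |Δ^n|`. -/
def muMap (θ : Simplex (Sharp m n) → n) : C(XSpace θ, Realization m × Realization n) :=
  ((Realization.map Prod.fst).prodMap (ContinuousMap.id _)).comp (XSpace.incl θ)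

section Theta

variable {G : Type v} [Group G] {C : Type*} [NonUnitalCStarAlgebra C] [GradedGAlg G C]
  [Nonempty m] [IsDirectedOrder m] [Nonempty n] [IsDirectedOrder n]

theorem muMap_mem {θ : Simplex (Sharp m n) → n} (hθ : Admissible θ)
    {f : Realization m →ᵇ (Realization n →ᵇ C)}
    (hf : cbMap (Realization m) (Ca.mk (G := G) (Realization n)) f ∈ C0 (Realization m) (Ca (Realization n) C)) :
    cbPull (G := G) (muMap θ) (cbUncurry (G := G) f) ∈ C0 (XSpace θ) C := by
  rw [mem_C0_iff] at hf ⊢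
  intro ε hε
  obtain ⟨i, -, hi⟩ := Realization.hasBasis_filt.eventually_iff.1 (hf ε hε)
  have hξ : ∀ ρ : Simplex m, ∃ j : n, (∀ s ∈ ρ.1, i ≤ s) →
      ∀ x ∈ Realization.face ρ.1, ∀ y ∈ Realization.tail j, ‖f x y‖ < ε := by
    intro ρ
    by_cases h : ∀ s ∈ ρ.1, i ≤ s
    · obtain ⟨j, hj⟩ := exists_tail_of_compact (G := G) (Realization.isCompact_face ρ.1) f
        (fun x hx => hi (fun s hs => h s (hx hs)))
      exact ⟨j, fun _ => hj⟩
    · exact ⟨Classical.arbitrary n, fun h' => absurd h' h⟩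
  choose ξ hξ using hξ
  refine mem_of_superset (mem_iInf_of_mem ((i, ξ) : Sharp m n) (mem_principal_self _)) ?_
  rintro ⟨⟨x, y⟩, σ, hxσ, hyσ⟩ hx
  change x ∈ Realization.tail ((i, ξ) : Sharp m n) at hx
  change ‖f (Realization.map Prod.fst x) y‖ < ε
  obtain ⟨p, hp⟩ := x.supp.2
  refine hξ (x.supp.map Prod.fst) ?_ _ ?_ y ?_
  · intro s hs
    classical
    obtain ⟨q, hq, rfl⟩ := Finset.mem_image.1 hs
    exact (hx q hq).1
  · intro s hs
    classical
    obtain ⟨q, hq, rfl⟩ := Realization.support_map _ _ hs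
    exact Finset.mem_image.2 ⟨q, hq, rfl⟩
  · intro s hs
    calc ξ (x.supp.map Prod.fst) ≤ p.2 (x.supp.map Prod.fst) := (hx p hp).2 _
      _ ≤ θ x.supp := hθ.ge _ p hp
      _ ≤ θ σ := hθ.mono _ _ hxσ
      _ ≤ s := hyσ s hs

theorem mk_comp_cbMap_mk_surj {X Y : Type*} [TopologicalSpace X] [FilterSpace X]
    [TopologicalSpace Y] [FilterSpace Y] : Function.Surjective
      ((Ca.mk (G := G) X).comp (cbMap X (Ca.mk (G := G) Y (B := C)))) :=
  (Ca.mk_surj (G := G)).comp (cbMap_mk_surj X)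

variable (G C) in
/-- The natural transformation `(|μ| × id)^* : C_a(|Δ^m|; C_a(|Δ^n|; C)) → C_a(X_θ; C)` to which
`C_b(|Δ^m|; C_b(|Δ^n|; C)) ⊆ C_b(|Δ^m| × |Δ^n|; C) → C_b(X_θ; C)` descends. -/
def muStar {θ : Simplex (Sharp m n) → n} (hθ : Admissible θ) :
    GHom G (Ca (Realization m) (Ca (Realization n) C)) (Ca (XSpace θ) C) :=
  GHom.descend ((Ca.mk (Realization m)).comp (cbMap (Realization m) (Ca.mk (Realization n)))) mk_comp_cbMap_mk_surj
    ((Ca.mk (XSpace θ)).comp ((cbPull (muMap θ)).comp cbUncurry)) fun _ hf =>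
      (Ca.mk_eq_zero (G := G)).2 (muMap_mem hθ ((Ca.mk_eq_zero (G := G)).1 hf))

theorem muStar_mk {θ : Simplex (Sharp m n) → n} (hθ : Admissible θ)
    (f : Realization m →ᵇ (Realization n →ᵇ C)) :
    muStar G C hθ (Ca.mk (G := G) (Realization m) (cbMap (Realization m) (Ca.mk (G := G) (Realization n)) f)) =
      Ca.mk (G := G) (XSpace θ) (cbPull (G := G) (muMap θ) (cbUncurry (G := G) f)) :=
  GHom.descend_apply _ _ _ _ f

theorem map_comp_muStar {B : Type*} [NonUnitalCStarAlgebra B] [GradedGAlg G B]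
    {θ : Simplex (Sharp m n) → n} (hθ : Admissible θ) (φ : GHom G B C) :
    (Ca.map (XSpace θ) φ).comp (muStar G B hθ) =
      (muStar G C hθ).comp (Ca.map (Realization m) (Ca.map (Realization n) φ)) := by
  refine GHom.ext fun a => ?_
  obtain ⟨f, rfl⟩ := mk_comp_cbMap_mk_surj (G := G) a
  have h : cbMap (Realization m) (Ca.map (Realization n) φ) (cbMap (Realization m) (Ca.mk (G := G) (Realization n)) f) =
      cbMap (Realization m) (Ca.mk (G := G) (Realization n)) (cbMap (Realization m) (cbMap (Realization n) φ) f) := by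
    ext x
    exact Ca.map_mk φ (f x)
  simp only [GHom.comp_apply, muStar_mk, Ca.map_mk, h]
  rfl

variable (m n) in
/-- The choices entering the definition of the reparametrization `Θ`: an admissible `θ`, and a
homotopy inverse `I` of the projection `P_θ : X_θ → |Δ^{m ♯ n}|` in the category of spaces with
filters, continuous filter-proper maps and continuous filter-proper homotopies. -/
structure Reparam where
  θ : Simplex (Sharp m n) → n
  admissible : Admissible θ
  I : C(Realization (Sharp m n), XSpace θ)
  proper : Tendsto I (FilterSpace.filt (X := Realization (Sharp m n))) (FilterSpace.filt (X := XSpace θ))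
  proj_comp : FilterHomotopic ((XSpace.proj θ).comp I) (ContinuousMap.id _)
  comp_proj : FilterHomotopic (I.comp (XSpace.proj θ)) (ContinuousMap.id _)

/-- The reparametrization `Θ = (|μ| × id) ∘ I : |Δ^{m ♯ n}| → |Δ^m| × |Δ^n|`. -/
def Reparam.Theta (R : Reparam m n) : C(Realization (Sharp m n), Realization m × Realization n) :=
  (muMap R.θ).comp R.I

variable (G C) in
/-- The natural transformation `Θ^* = I^* ∘ (|μ| × id)^*` induced by `Θ`. -/
def Reparam.thetaStar (R : Reparam m n) :
    GHom G (Ca (Realization m) (Ca (Realization n) C)) (Ca (Realization (Sharp m n)) C) :=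
  (Ca.pull R.I R.proper).comp (muStar G C R.admissible)

theorem Reparam.thetaStar_mk (R : Reparam m n) (f : Realization m →ᵇ (Realization n →ᵇ C)) :
    R.thetaStar G C (Ca.mk (G := G) (Realization m) (cbMap (Realization m) (Ca.mk (G := G) (Realization n)) f)) =
      Ca.mk (G := G) (Realization (Sharp m n)) (cbPull (G := G) R.Theta (cbUncurry (G := G) f)) := by
  rw [thetaStar, GHom.comp_apply, muStar_mk, Ca.pull_mk]
  rfl

theorem Reparam.map_comp_thetaStar (R : Reparam m n) {B : Type*} [NonUnitalCStarAlgebra B]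
    [GradedGAlg G B] (φ : GHom G B C) :
    (Ca.map (Realization (Sharp m n)) φ).comp (R.thetaStar G B) =
      (R.thetaStar G C).comp (Ca.map (Realization m) (Ca.map (Realization n) φ)) := by
  rw [thetaStar, ← GHom.comp_assoc, Ca.map_comp_pull, GHom.comp_assoc, map_comp_muStar]
  rfl

/-- The composition product `⟦A, B⟧_m × ⟦B, C⟧_n → ⟦A, C⟧_{m ♯ n}`,
`(⟦φ⟧, ⟦ψ⟧) ↦ Θ^* ⟦C_a(|Δ^m|; ψ) ∘ φ⟧`. -/
def Reparam.compProd (R : Reparam m n) {A B : Type*} [NonUnitalCStarAlgebra A] [GradedGAlg G A]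
    [NonUnitalCStarAlgebra B] [GradedGAlg G B] :
    Cls G (Realization m) A B → Cls G (Realization n) B C → Cls G (Realization (Sharp m n)) A C :=
  Quot.map₂ (fun φ ψ => (R.thetaStar G C).comp ((Ca.map (Realization m) ψ).comp φ))
    (by
      rintro φ _ _ ⟨Ψ, rfl, rfl⟩
      refine ⟨(R.thetaStar G _).comp ((Ca.map (Realization m) Ψ).comp φ), ?_, ?_⟩ <;>
        rw [← GHom.comp_assoc, R.map_comp_thetaStar, Ca.map_map] <;> rfl)
    (by
      rintro _ _ ψ ⟨Φ, rfl, rfl⟩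
      have h : ∀ t : unitInterval, (Ca.map (Realization (Sharp m n)) (ev t)).comp
          ((R.thetaStar G _).comp ((Ca.map (Realization m)
            ((caSwap G (Realization n) C).comp (cbMap unitInterval ψ))).comp Φ)) =
          (R.thetaStar G C).comp ((Ca.map (Realization m) ψ).comp ((Ca.map (Realization m) (ev t)).comp Φ)) := by
        intro t
        rw [← GHom.comp_assoc, R.map_comp_thetaStar, GHom.comp_assoc, ← GHom.comp_assoc _ _ Φ,
          ← Ca.map_map, ← GHom.comp_assoc (Ca.map (Realization n) (ev t)), map_ev_caSwap,
          show (ev t).comp (cbMap unitInterval ψ) = ψ.comp (ev t) from rfl, Ca.map_map]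
        rfl
      exact ⟨_, h 0, h 1⟩)

end Theta

/-! ### The simpltotic morphism sets -/

/-- Non-empty directed sets. -/
structure DirSet where
  carrier : Type u
  [preorder : Preorder carrier]
  [nonempty : Nonempty carrier]
  [directed : IsDirectedOrder carrier]

instance : CoeSort DirSet.{u} (Type u) := ⟨DirSet.carrier⟩

attribute [instance] DirSet.preorder DirSet.nonempty DirSet.directed

/-- `m ♯ n` as a directed set. -/
abbrev DirSet.sharp (m n : DirSet.{u}) : DirSet.{u} :=
  letI := directed_pi (Simplex m) n
  letI := directed_prod m (Simplex m → n)
  ⟨Sharp m n⟩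

section Limit

variable (G : Type v) [Group G] (A B : Type u) [NonUnitalCStarAlgebra A] [GradedGAlg G A]
  [NonUnitalCStarAlgebra B] [GradedGAlg G B]

/-- `⟦A, B⟧_m` for a directed set `m`. -/
abbrev DirCls (m : Type u) [Preorder m] : Type u := Cls G (Realization m) A B

variable {G A B} in
/-- The map `α^* : ⟦A, B⟧_n → ⟦A, B⟧_m` induced by a cofinal map `α : m → n`. -/
def DirCls.pull {m n : Type u} [Preorder m] [Preorder n] (α : m → n) (hα : Cofinal α) :
    DirCls G A B n → DirCls G A B m :=
  Cls.pull (Realization.map α) hα.tendsto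

/-- `⟦A, B⟧`: the direct limit of the sets `⟦A, B⟧_m` over all directed sets `m` and the maps
induced by cofinal maps. -/
def SimplMor : Type (u + 1) :=
  Quot fun x y : (Σ m : DirSet.{u}, DirCls G A B m) =>
    ∃ (α : y.1 → x.1) (hα : Cofinal α), y.2 = DirCls.pull α hα x.2

variable {G A B} in
/-- The canonical map `⟦A, B⟧_m → ⟦A, B⟧`. -/
def SimplMor.of (m : DirSet.{u}) (x : DirCls G A B m) : SimplMor G A B := Quot.mk _ ⟨m, x⟩

end Limit

end

end Simpltotic

open Simpltotic

namespace Simpltotic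

noncomputable section

/-! ### Topology of geometric realizations -/

/-! The obstacle to finding `I` is that the condition on the second coordinate over `x`, that its
vertices be at least `θ (supp x)`, jumps up as soon as a new vertex enters the support of `x`. The
remedy is to let the first coordinate lag behind. `collapse` discards the coordinates of `x` below a
positive threshold, and `spread` sends `x` continuously to a convex combination of simplices `σ`
with `supp (collapse x) ⊆ σ ⊆ supp x`. If `θ` is monotone, all vertices `θ σ` of `|θ|(spread x)` are
at least `θ (supp (collapse x))`, so `x ↦ (collapse x, |θ|(spread x))` takes values in `X_θ`; this
is `XSpace.lift`. Straight lines, run in one coordinate after the other, show that it is a homotopy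
inverse of the projection. Monotone `θ` above prescribed values exist by recursion over finite sets
(`exists_monotone_ge`).

All compatibility statements are instances of `Reparam.pull_compProd`. Let `α : m' → m`, `β : n' →
n`, `δ : k → m ♯ n` and `γ : k → m' ♯ n'` be cofinal with `μ ∘ δ = α ∘ μ ∘ γ`. For a sufficiently
large monotone `κ : Δ^k → n'`, both `|δ| × |β| : X_κ → X_θ` and `|γ| × id : X_κ → X_θ'` are defined,
and their composites to `|Δ^m| × |Δ^n|` coincide. Hence the two products agree on `X_κ`, before any
choice of `I` enters (`pull_map_comp_muStar`). The projections of `X_κ`, `X_θ` and `X_θ'` are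
homotopy equivalences and pullback of classes is homotopy invariant
(`Cls.pull_eq_of_filterHomotopic`), so the agreement descends to `|Δ^k|`.

Taking all four maps to be identities gives independence of the choices; `α = id` and `β = id` give
the two compatibilities, and these make the product well defined on direct limits. -/

/-- Currying turns `f` into a map from `X` to `C(Y, Z)`, whose continuity can be tested on the
members of `S`; local compactness of `Y` allows uncurrying. With `Y = [0,1]` this reduces homotopies
to finite subcomplexes. -/
theorem continuous_prod_of_isCoherentWith {X Y Z : Type*} [TopologicalSpace X] [TopologicalSpace Y]
    [LocallyCompactSpace Y] [TopologicalSpace Z] {S : Set (Set X)} (hS : IsCoherentWith S)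
    (hcover : ∀ x, ∃ s ∈ S, x ∈ s) {f : X × Y → Z}
    (hf : ∀ s ∈ S, Continuous fun p : s × Y => f (p.1, p.2)) : Continuous f := by
  have h : ∀ x, Continuous fun y => f (x, y) := fun x => by
    obtain ⟨s, hs, hx⟩ := hcover x
    exact (hf s hs).comp (f := fun y : Y => ((⟨x, hx⟩ : s), y)) (by fun_prop)
  let F : X → C(Y, Z) := fun x => ⟨fun y => f (x, y), h x⟩
  have hF : Continuous F := hS.continuous_iff.2 fun s hs => by
    rw [continuousOn_iff_continuous_domRestrict]
    exact (ContinuousMap.curry ⟨_, hf s hs⟩).continuous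
  exact ContinuousMap.continuous_uncurry_of_continuous ⟨F, hF⟩

namespace Realization

variable {S T : Type u}

theorem isCoherentWith_face : IsCoherentWith (Set.range (face (S := S))) where
  isOpen_of_forall_induced s hs := by
    refine isOpen_iSup_iff.2 fun σ => isOpen_coinduced.2 ?_
    have hmem : ∀ w, faceIncl σ w ∈ face σ := fun w => face_eq_range σ ▸ Set.mem_range_self w
    exact (hs _ ⟨σ, rfl⟩).preimage ((continuous_faceIncl σ).subtype_mk hmem)

theorem mem_face_support (x : Realization S) : x ∈ face x.weights.support :=
  fun _ h => h

theorem continuous_prod {Y Z : Type*} [TopologicalSpace Y] [LocallyCompactSpace Y]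
    [TopologicalSpace Z] {f : Realization S × Y → Z}
    (hf : ∀ σ : Finset S, Continuous fun p : face σ × Y => f (p.1, p.2)) : Continuous f :=
  continuous_prod_of_isCoherentWith isCoherentWith_face
    (fun x => ⟨_, ⟨_, rfl⟩, mem_face_support x⟩) (by rintro _ ⟨σ, rfl⟩; exact hf σ)

theorem continuous_of_face {Z : Type*} [TopologicalSpace Z] {f : Realization S → Z}
    (hf : ∀ σ : Finset S, Continuous fun p : face σ => f p) : Continuous f :=
  isCoherentWith_face.continuous_iff.2 (by
    rintro _ ⟨σ, rfl⟩
    exact continuousOn_iff_continuous_domRestrict.2 (hf σ))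

theorem weights_faceIncl (σ : Finset S) (w : stdSimplex ℝ σ) {s : S} (hs : s ∈ σ) :
    (faceIncl σ w).weights s = w ⟨s, hs⟩ :=
  Finsupp.mapDomain_apply Subtype.val_injective _ (⟨s, hs⟩ : σ)

theorem faceIncl_mem (σ : Finset S) (w : stdSimplex ℝ σ) : faceIncl σ w ∈ face σ :=
  face_eq_range σ ▸ Set.mem_range_self w

theorem weights_eq_zero {σ : Finset S} {x : Realization S} (hx : x ∈ face σ) {s : S}
    (hs : s ∉ σ) : x.weights s = 0 := by
  by_contra h
  exact hs (hx (Finsupp.mem_support_iff.2 h))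

theorem continuous_weights (s : S) : Continuous fun x : Realization S => x.weights s := by
  refine continuous_iff.2 fun σ => ?_
  by_cases hs : s ∈ σ
  · have : (fun x : Realization S => x.weights s) ∘ faceIncl σ = fun w => w ⟨s, hs⟩ := by
      funext w
      exact weights_faceIncl σ w hs
    rw [this]
    exact (continuous_apply _).comp continuous_subtype_val
  · have : (fun x : Realization S => x.weights s) ∘ faceIncl σ = fun w => 0 := by
      funext w
      exact weights_eq_zero (faceIncl_mem σ w) hs
    rw [this]
    exact continuous_const

theorem sum_weights {σ : Finset S} {x : Realization S} (hx : x ∈ face σ) :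
    ∑ s ∈ σ, x.weights s = 1 := by
  rw [← x.total, Finsupp.sum_of_support_subset _ hx _ (fun _ _ => rfl)]

theorem ext_weights {x y : Realization S} (h : ∀ s, x.weights s = y.weights s) : x = y :=
  Convexity.StdSimplex.ext (Finsupp.ext h)

/-- A map into a geometric simplex is continuous if its barycentric coordinates are. -/
theorem continuous_of_weights {Z : Type*} [TopologicalSpace Z] {f : Z → Realization T}
    (σ : Finset T) (hσ : ∀ z, f z ∈ face σ) (hf : ∀ t ∈ σ, Continuous fun z => (f z).weights t) :
    Continuous f := by
  let g : Z → stdSimplex ℝ σ := fun z => ⟨fun t => (f z).weights t, fun t => (f z).nonneg t, by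
    rw [← sum_weights (hσ z)]
    exact Finset.sum_coe_sort σ (fun s => (f z).weights s)⟩
  have hg : Continuous g := Continuous.subtype_mk (continuous_pi fun t : σ => hf t.1 t.2) _
  have : f = faceIncl σ ∘ g := by
    funext z
    refine ext_weights fun t => ?_
    by_cases ht : t ∈ σ
    · exact (weights_faceIncl σ (g z) ht).symm
    · rw [weights_eq_zero (hσ z) ht, Function.comp_apply, weights_eq_zero (faceIncl_mem σ _) ht]
  exact this ▸ (continuous_faceIncl σ).comp hg

/-- The point `(1 - t) x + t y` on the segment between two points. -/
def segment (x y : Realization S) (t : unitInterval) : Realization S where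
  weights := (1 - t : ℝ) • x.weights + (t : ℝ) • y.weights
  nonneg s := add_nonneg (mul_nonneg (sub_nonneg.2 t.2.2) (x.nonneg s))
    (mul_nonneg t.2.1 (y.nonneg s))
  total := by
    classical
    rw [Finsupp.sum_add_index' (fun _ => rfl) (fun _ _ _ => rfl),
      Finsupp.sum_smul_index' (fun _ => rfl), Finsupp.sum_smul_index' (fun _ => rfl)]
    have hx := x.total
    have hy := y.total
    simp only [Finsupp.sum, smul_eq_mul, ← Finset.mul_sum] at hx hy ⊢
    rw [hx, hy]
    ring

theorem weights_segment (x y : Realization S) (t : unitInterval) (s : S) :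
    (segment x y t).weights s = (1 - t) * x.weights s + t * y.weights s := rfl

@[simp] theorem segment_zero (x y : Realization S) : segment x y 0 = x :=
  ext_weights fun s => by simp [weights_segment]

@[simp] theorem segment_one (x y : Realization S) : segment x y 1 = y :=
  ext_weights fun s => by simp [weights_segment]

theorem mem_support_segment {x y : Realization S} {t : unitInterval} {s : S}
    (hs : s ∈ (segment x y t).weights.support) :
    s ∈ x.weights.support ∨ s ∈ y.weights.support := by
  by_contra! h
  refine Finsupp.mem_support_iff.1 hs ?_
  rw [weights_segment, Finsupp.notMem_support_iff.1 h.1, Finsupp.notMem_support_iff.1 h.2]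
  simp

theorem segment_mem_face {σ : Finset S} {x y : Realization S} (hx : x ∈ face σ) (hy : y ∈ face σ)
    (t : unitInterval) : segment x y t ∈ face σ :=
  fun _ hs => (mem_support_segment hs).elim (@hx _) (@hy _)

theorem segment_mem_tail [Preorder S] {i : S} {x y : Realization S} (hx : x ∈ tail i)
    (hy : y ∈ tail i) (t : unitInterval) : segment x y t ∈ tail i :=
  fun s hs => (mem_support_segment hs).elim (hx s) (hy s)

theorem map_mem_face [DecidableEq T] (α : S → T) {σ : Finset S} {x : Realization S}
    (hx : x ∈ face σ) : map α x ∈ face (σ.image α) := fun t ht => by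
  obtain ⟨s, hs, rfl⟩ := support_map α x ht
  exact Finset.mem_image_of_mem α (hx hs)

end Realization

/-! ### The weak topology of `X_θ` -/

namespace XSpace

variable {k n : Type u} [Preorder n] {θ : Simplex k → n}

variable (θ) in
/-- The intersection of `X_θ` with the product of two geometric simplices. -/
def piece (c : Finset k × Finset n) : Set (XSpace θ) :=
  {p | p.1.1 ∈ Realization.face c.1 ∧ p.1.2 ∈ Realization.face c.2}

theorem continuous_of_incl {Z : Type*} [TopologicalSpace Z] {f : Z → XSpace θ}
    (c : Finset k × Finset n) (hc : ∀ z, f z ∈ piece θ c) (hf : Continuous fun z => (f z).1) :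
    Continuous f := by
  let t : TopologicalSpace {p : XSpace θ // p.1.1 ∈ Realization.face c.1 ∧
      p.1.2 ∈ Realization.face c.2} := TopologicalSpace.induced (fun p => p.1.1) inferInstance
  have h : Continuous[t, _] Subtype.val :=
    continuous_iff_coinduced_le.2 (le_iSup (fun c : Finset k × Finset n =>
      TopologicalSpace.coinduced (Subtype.val : {p : XSpace θ // p.1.1 ∈ Realization.face c.1 ∧
        p.1.2 ∈ Realization.face c.2} → XSpace θ)
        (TopologicalSpace.induced (fun p => p.1.1) inferInstance)) c)
  have hg : Continuous[_, t] fun z => ⟨f z, hc z⟩ := continuous_induced_rng.2 hf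
  exact @Continuous.comp _ _ _ _ t _ _ _ h hg

theorem isCoherentWith_piece : IsCoherentWith (Set.range (piece θ)) where
  isOpen_of_forall_induced s hs := by
    refine isOpen_iSup_iff.2 fun c => ?_
    refine @isOpen_coinduced _ _ (_) _ _ |>.2 ?_
    let _ : TopologicalSpace {p : XSpace θ // p.1.1 ∈ Realization.face c.1 ∧
        p.1.2 ∈ Realization.face c.2} := TopologicalSpace.induced (fun p => p.1.1) inferInstance
    have h : Continuous (Subtype.val : {p : XSpace θ // p.1.1 ∈ Realization.face c.1 ∧
        p.1.2 ∈ Realization.face c.2} → XSpace θ) :=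
      continuous_of_incl c (fun p => p.2) continuous_induced_dom
    exact (hs _ ⟨c, rfl⟩).preimage (h.subtype_mk fun p => p.2)

theorem exists_mem_piece (p : XSpace θ) : ∃ s ∈ Set.range (piece θ), p ∈ s :=
  ⟨_, ⟨(p.1.1.weights.support, p.1.2.weights.support), rfl⟩,
    Realization.mem_face_support _, Realization.mem_face_support _⟩

theorem continuous_prod {Y Z : Type*} [TopologicalSpace Y] [LocallyCompactSpace Y]
    [TopologicalSpace Z] {f : XSpace θ × Y → Z}
    (hf : ∀ c, Continuous fun p : piece θ c × Y => f (p.1, p.2)) : Continuous f :=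
  continuous_prod_of_isCoherentWith isCoherentWith_piece exists_mem_piece
    (by rintro _ ⟨c, rfl⟩; exact hf c)

theorem continuous_of_piece {Z : Type*} [TopologicalSpace Z] {f : XSpace θ → Z}
    (hf : ∀ c, Continuous fun p : piece θ c => f p) : Continuous f :=
  isCoherentWith_piece.continuous_iff.2 (by
    rintro _ ⟨σ, rfl⟩
    exact continuousOn_iff_continuous_domRestrict.2 (hf σ))

end XSpace

/-! ### Sections of `X_θ` up to homotopy -/

namespace Realization

variable {S T : Type u}

/-- The point whose barycentric coordinates are proportional to a function. -/
def ofFun (f : S → ℝ) (σ : Finset S) (hσ : ∀ s, f s ≠ 0 → s ∈ σ) (h0 : ∀ s, 0 ≤ f s)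
    (hp : ∃ s, f s ≠ 0) : Realization S where
  weights := Finsupp.onFinset σ (fun s => f s / ∑ t ∈ σ, f t) fun s hs =>
    hσ s fun h => hs (by rw [h, zero_div])
  nonneg s := div_nonneg (h0 s) (Finset.sum_nonneg fun t _ => h0 t)
  total := by
    rw [Finsupp.onFinset_sum _ fun _ => rfl, ← Finset.sum_div]
    obtain ⟨s, hs⟩ := hp
    refine div_self (ne_of_gt ?_)
    exact Finset.sum_pos' (fun t _ => h0 t) ⟨s, hσ s hs, (h0 s).lt_of_ne' hs⟩

section

variable {f : S → ℝ} {σ : Finset S} {hσ : ∀ s, f s ≠ 0 → s ∈ σ} {h0 : ∀ s, 0 ≤ f s}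
  {hp : ∃ s, f s ≠ 0}

theorem mem_support_ofFun {s : S} : s ∈ (ofFun f σ hσ h0 hp).weights.support ↔ f s ≠ 0 := by
  rw [Finsupp.mem_support_iff]
  change f s / _ ≠ 0 ↔ _
  refine ⟨fun h h' => h (by rw [h', zero_div]), fun h => div_ne_zero h (ne_of_gt ?_)⟩
  exact Finset.sum_pos' (fun t _ => h0 t) ⟨s, hσ s h, (h0 s).lt_of_ne' h⟩

/-- The normalizing sum may be taken over any finite set outside which `f` vanishes. This replaces a
set varying with the point by a fixed one in continuity arguments. -/
theorem weights_ofFun {τ : Finset S} (hτ : ∀ s, f s ≠ 0 → s ∈ τ) (s : S) :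
    (ofFun f σ hσ h0 hp).weights s = f s / ∑ t ∈ τ, f t := by
  classical
  change f s / _ = _
  congr 1
  rw [← Finset.sum_subset (Finset.inter_subset_left (s₁ := σ) (s₂ := τ)),
    ← Finset.sum_subset (Finset.inter_subset_right (s₁ := σ) (s₂ := τ))]
  all_goals
    intro t h1 h2
    by_contra h
    exact h2 (Finset.mem_inter.2 ⟨hσ t h, hτ t h⟩)

end

theorem continuous_ofFun {Z : Type*} [TopologicalSpace Z] {f : Z → S → ℝ} {σ : Z → Finset S}
    {hσ : ∀ z s, f z s ≠ 0 → s ∈ σ z} {h0 : ∀ z s, 0 ≤ f z s} {hp : ∀ z, ∃ s, f z s ≠ 0}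
    (τ : Finset S) (hτ : ∀ z s, f z s ≠ 0 → s ∈ τ)
    (hf : ∀ s ∈ τ, Continuous fun z => f z s) :
    Continuous fun z => ofFun (f z) (σ z) (hσ z) (h0 z) (hp z) := by
  refine continuous_of_weights τ (fun z s hs => hτ z s (mem_support_ofFun.1 hs)) fun s hs => ?_
  simp only [weights_ofFun (hτ _)]
  refine (hf s hs).div (continuous_finsetSum _ hf) fun z => ne_of_gt ?_
  obtain ⟨s, hs⟩ := hp z
  exact Finset.sum_pos' (fun t _ => h0 z t) ⟨s, hτ z s hs, (h0 z s).lt_of_ne' hs⟩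

/-- The sum of the squares of the barycentric coordinates. -/
def sqSum (x : Realization S) : ℝ := ∑ s ∈ x.weights.support, x.weights s ^ 2

theorem sqSum_eq {σ : Finset S} {x : Realization S} (hx : x ∈ face σ) :
    sqSum x = ∑ s ∈ σ, x.weights s ^ 2 :=
  Finset.sum_subset hx fun s _ hs => by simp [Finsupp.notMem_support_iff.1 hs]

theorem sqSum_pos (x : Realization S) : 0 < sqSum x := by
  refine Finset.sum_pos (fun s hs => ?_) x.support_weights_nonempty
  have := Finsupp.mem_support_iff.1 hs
  positivity

/-- With `q = sqSum x`, if all coordinates were at most `q / 2`, then `q = ∑ x_s² ≤ (q / 2) ∑ x_s =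
q / 2`, contradicting `q > 0`. So some coordinate survives the threshold of `collapse`. -/
theorem exists_sqSum_half_lt (x : Realization S) : ∃ s, sqSum x / 2 < x.weights s := by
  by_contra! h
  have h1 : sqSum x ≤ ∑ s ∈ x.weights.support, sqSum x / 2 * x.weights s :=
    Finset.sum_le_sum fun s _ => by
      rw [sq]
      exact mul_le_mul_of_nonneg_right (h s) (x.nonneg s)
  rw [← Finset.mul_sum, sum_weights (mem_face_support x)] at h1
  linarith [sqSum_pos x]

theorem continuous_sqSum_face (σ : Finset S) : Continuous fun x : face σ => sqSum x.1 := by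
  simp only [sqSum_eq (Subtype.prop _)]
  exact continuous_finsetSum _ fun s _ =>
    ((continuous_weights s).comp continuous_subtype_val).pow 2

theorem mem_support_of_max_ne_zero {x : Realization S} {s : S}
    (h : max (x.weights s - sqSum x / 2) 0 ≠ 0) : s ∈ x.weights.support := by
  refine Finsupp.mem_support_iff.2 fun h' => h (max_eq_right ?_)
  linarith [sqSum_pos x]

/-- The map which collapses neighbourhoods of the faces, by discarding small coordinates. -/
def collapse (x : Realization S) : Realization S :=
  ofFun (fun s => max (x.weights s - sqSum x / 2) 0) x.weights.support
    (fun _ h => mem_support_of_max_ne_zero h) (fun _ => le_max_right _ _) (by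
      obtain ⟨s, hs⟩ := exists_sqSum_half_lt x
      exact ⟨s, ne_of_gt (lt_max_of_lt_left (sub_pos.2 hs))⟩)

theorem mem_support_collapse {x : Realization S} {s : S} :
    s ∈ (collapse x).weights.support ↔ sqSum x / 2 < x.weights s := by
  rw [collapse, mem_support_ofFun]
  simp

theorem support_collapse_subset (x : Realization S) :
    (collapse x).weights.support ⊆ x.weights.support := fun s hs => by
  rw [mem_support_collapse] at hs
  exact Finsupp.mem_support_iff.2 (by linarith [sqSum_pos x])

theorem continuous_collapse : Continuous (collapse (S := S)) := by
  refine continuous_of_face fun σ => ?_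
  refine continuous_ofFun σ (fun x s hs => x.2 (mem_support_of_max_ne_zero hs)) fun s _ => ?_
  exact (((continuous_weights s).comp continuous_subtype_val).sub
    ((continuous_sqSum_face σ).div_const 2)).max continuous_const

open scoped Classical in
/-- The coordinate at the face `σ` (not normalized) of the image of `x` in `|Δ^{Δ^S}|`. -/
def faceWeight (x : Realization S) (σ : Finset S) : ℝ :=
  (∏ s ∈ σ, x.weights s) * ∏ s ∈ x.weights.support \ σ, max (1 - 2 * x.weights s / sqSum x) 0

open scoped Classical in
-- A vanishing coordinate contributes the factor `1` to the second product, so the support can be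
-- replaced by any larger finite set. This makes the weight continuous on each geometric simplex
-- although supports jump.
theorem faceWeight_eq {τ : Finset S} {x : Realization S} (hx : x ∈ face τ) (σ : Finset S) :
    faceWeight x σ = (∏ s ∈ σ, x.weights s) *
      ∏ s ∈ τ \ σ, max (1 - 2 * x.weights s / sqSum x) 0 := by
  rw [faceWeight, Finset.prod_subset (Finset.sdiff_subset_sdiff hx subset_rfl)]
  intro s h1 h2
  have : x.weights s = 0 := Finsupp.notMem_support_iff.1 fun h =>
    h2 (Finset.mem_sdiff.2 ⟨h, (Finset.mem_sdiff.1 h1).2⟩)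
  simp [this]

theorem faceWeight_nonneg (x : Realization S) (σ : Finset S) : 0 ≤ faceWeight x σ :=
  mul_nonneg (Finset.prod_nonneg fun s _ => x.nonneg s)
    (Finset.prod_nonneg fun _ _ => le_max_right _ _)

theorem faceWeight_support_ne_zero (x : Realization S) : faceWeight x x.weights.support ≠ 0 := by
  classical
  rw [faceWeight, Finset.sdiff_self, Finset.prod_empty, mul_one]
  exact Finset.prod_ne_zero_iff.2 fun s hs => Finsupp.mem_support_iff.1 hs

theorem subset_support_of_faceWeight {x : Realization S} {σ : Finset S}
    (h : faceWeight x σ ≠ 0) : σ ⊆ x.weights.support := fun _ hs =>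
  Finsupp.mem_support_iff.2 (Finset.prod_ne_zero_iff.1 (left_ne_zero_of_mul h) _ hs)

/-- A vertex surviving in `collapse x` has `x_s > sqSum x / 2`; if it were outside `σ`, its factor
`max (1 - 2 x_s / sqSum x) 0` would be zero. -/
theorem support_collapse_subset_of_faceWeight {x : Realization S} {σ : Finset S}
    (h : faceWeight x σ ≠ 0) : (collapse x).weights.support ⊆ σ := fun s hs => by
  classical
  by_contra hsσ
  refine Finset.prod_ne_zero_iff.1 (right_ne_zero_of_mul h) s
    (Finset.mem_sdiff.2 ⟨support_collapse_subset x hs, hsσ⟩) (max_eq_right ?_)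
  rw [mem_support_collapse] at hs
  rw [sub_nonpos, le_div_iff₀ (sqSum_pos x)]
  linarith

theorem continuous_faceWeight_face (τ σ : Finset S) :
    Continuous fun x : face τ => faceWeight x.1 σ := by
  classical
  simp only [faceWeight_eq (Subtype.prop _)]
  have hw : ∀ s, Continuous fun x : face τ => x.1.weights s := fun s =>
    (continuous_weights s).comp continuous_subtype_val
  refine (continuous_finsetProd _ fun s _ => hw s).mul (continuous_finsetProd _ fun s _ => ?_)
  exact (continuous_const.sub (((hw s).const_mul 2).div (continuous_sqSum_face τ)
    fun x => (sqSum_pos x.1).ne')).max continuous_const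

open scoped Classical in
/-- The simplices contained in a finite set of vertices. -/
def subsimplices (σ : Finset S) : Finset (Simplex S) :=
  σ.powerset.subtype Finset.Nonempty

theorem mem_subsimplices {σ : Finset S} {ς : Simplex S} : ς ∈ subsimplices σ ↔ ς.1 ⊆ σ := by
  classical
  exact Finset.mem_subtype.trans Finset.mem_powerset

/-- A map from `|Δ^S|` to the realization of the full complex on the set of its simplices, which
sends `x` to a combination of simplices between the supports of `collapse x` and `x`. -/
def spread (x : Realization S) : Realization (Simplex S) :=
  ofFun (fun σ => faceWeight x σ.1) (subsimplices x.weights.support)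
    (fun _ h => mem_subsimplices.2 (subset_support_of_faceWeight h))
    (fun _ => faceWeight_nonneg _ _) ⟨x.supp, faceWeight_support_ne_zero x⟩

theorem mem_support_spread {x : Realization S} {σ : Simplex S} :
    σ ∈ (spread x).weights.support ↔ faceWeight x σ.1 ≠ 0 :=
  mem_support_ofFun (f := fun σ : Simplex S => faceWeight x σ.1)

theorem spread_mem_face {σ : Finset S} {x : Realization S} (hx : x ∈ face σ) :
    spread x ∈ face (subsimplices σ) := fun _ hς =>
  mem_subsimplices.2 ((subset_support_of_faceWeight (mem_support_spread.1 hς)).trans hx)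

theorem continuous_spread : Continuous (spread (S := S)) := by
  refine continuous_of_face fun σ => ?_
  exact continuous_ofFun (subsimplices σ) (fun x s hs => mem_subsimplices.2
    ((subset_support_of_faceWeight hs).trans x.2)) fun s _ => continuous_faceWeight_face σ s.1

/-- The straight line homotopy on a space mapping to a geometric simplex. -/
theorem continuous_segment {Z : Type*} [TopologicalSpace Z] {f g : Z → Realization S}
    {t : Z → unitInterval} (σ : Finset S) (hf : Continuous f) (hg : Continuous g)
    (ht : Continuous t) (hfσ : ∀ z, f z ∈ face σ) (hgσ : ∀ z, g z ∈ face σ) :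
    Continuous fun z => segment (f z) (g z) (t z) := by
  refine continuous_of_weights σ (fun z => segment_mem_face (hfσ z) (hgσ z) _) fun s _ => ?_
  have hf' := (continuous_weights s).comp hf
  have hg' := (continuous_weights s).comp hg
  have ht' := continuous_subtype_val.comp ht
  exact ((continuous_const.sub ht').mul hf').add (ht'.mul hg')

/-- `collapse` is homotopic to the identity. -/
theorem filterHomotopic_collapse [Preorder S] :
    FilterHomotopic ⟨collapse (S := S), continuous_collapse⟩ (ContinuousMap.id _) := by
  refine ⟨⟨fun p => segment (collapse p.1) p.1 p.2, continuous_prod fun σ => ?_⟩,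
    fun x => segment_zero _ _, fun x => segment_one _ _, ?_⟩
  · have h : Continuous fun p : face σ × unitInterval => p.1.1 :=
      continuous_subtype_val.comp continuous_fst
    exact continuous_segment σ (continuous_collapse.comp h) h continuous_snd
      (fun p => (support_collapse_subset _).trans p.1.2) fun p => p.1.2
  · refine tendsto_iInf.2 fun j => tendsto_principal.2 ?_
    refine mem_of_superset (preimage_mem_comap (mem_iInf_of_mem j (mem_principal_self _))) ?_
    intro p hp
    exact segment_mem_tail (fun s hs => hp s (support_collapse_subset _ hs)) hp _

end Realization

/-! ### The homotopy inverse of the projection -/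

namespace XSpace

open Realization

variable {k n : Type u}

theorem map_spread_mem_face [DecidableEq n] {θ : Simplex k → n} {σ : Finset k} {x : Realization k}
    (hx : x ∈ face σ) : Realization.map θ (spread x) ∈ face ((subsimplices σ).image θ) :=
  map_mem_face θ (spread_mem_face hx)

variable [Preorder n] {θ : Simplex k → n}

/-- A simplex witnessing membership in `X_θ` contains the support of the first coordinate, so by
monotonicity the support itself is a witness. -/
theorem snd_mem_tail (hθ : ∀ ς σ : Simplex k, ς.1 ⊆ σ.1 → θ ς ≤ θ σ) (p : XSpace θ) :
    p.1.2 ∈ tail (θ p.1.1.supp) := by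
  obtain ⟨⟨x, y⟩, σ, hx, hy⟩ := p
  exact fun s hs => (hθ (supp x) σ hx).trans (hy s hs)

/-- Every simplex occurring in `spread x` contains the support of `collapse x`, and `θ` is monotone.
-/
theorem map_spread_mem_tail (hθ : ∀ ς σ : Simplex k, ς.1 ⊆ σ.1 → θ ς ≤ θ σ)
    (x : Realization k) : Realization.map θ (spread x) ∈ tail (θ (collapse x).supp) := fun t ht => by
  obtain ⟨σ, hσ, rfl⟩ := support_map θ _ ht
  exact hθ _ _ (support_collapse_subset_of_faceWeight (mem_support_spread.1 hσ))

/-- A section of the projection `P_θ` up to homotopy. -/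
def lift (hθ : ∀ ς σ : Simplex k, ς.1 ⊆ σ.1 → θ ς ≤ θ σ) : C(Realization k, XSpace θ) where
  toFun x := ⟨(collapse x, Realization.map θ (spread x)), (collapse x).supp, fun _ h => h,
    map_spread_mem_tail hθ x⟩
  continuous_toFun := by
    classical
    refine continuous_of_face fun σ => continuous_of_incl (σ, (subsimplices σ).image θ)
      (fun x => ⟨(support_collapse_subset _).trans x.2, map_spread_mem_face x.2⟩) ?_
    exact (continuous_collapse.comp continuous_subtype_val).prodMk
      ((Realization.map θ).continuous.comp (continuous_spread.comp continuous_subtype_val))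

theorem tendsto_lift [Preorder k] (hθ : ∀ ς σ : Simplex k, ς.1 ⊆ σ.1 → θ ς ≤ θ σ) :
    Tendsto (lift hθ) (FilterSpace.filt (X := Realization k)) (FilterSpace.filt (X := XSpace θ)) := by
  refine tendsto_iInf.2 fun j => tendsto_principal.2 ?_
  refine mem_of_superset (mem_iInf_of_mem j (mem_principal_self _)) fun x hx s hs => ?_
  exact hx s (support_collapse_subset _ hs)

variable (θ) in
theorem tendsto_proj [Preorder k] :
    Tendsto (proj θ) (FilterSpace.filt (X := XSpace θ)) (FilterSpace.filt (X := Realization k)) :=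
  tendsto_iInf.2 fun j => tendsto_principal.2 (mem_iInf_of_mem j (mem_principal_self _))

theorem proj_comp_lift [Preorder k] (hθ : ∀ ς σ : Simplex k, ς.1 ⊆ σ.1 → θ ς ≤ θ σ) :
    FilterHomotopic ((proj θ).comp (lift hθ)) (ContinuousMap.id _) :=
  filterHomotopic_collapse

/-- The map `t ↦ max (2 t - 1) 0`. -/
def lateTime (t : unitInterval) : unitInterval :=
  Set.projIcc 0 1 zero_le_one (2 * t - 1 : ℝ)

/-- The map `t ↦ min (2 t) 1`. -/
def earlyTime (t : unitInterval) : unitInterval :=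
  Set.projIcc 0 1 zero_le_one (2 * t : ℝ)

theorem continuous_lateTime : Continuous lateTime :=
  continuous_projIcc.comp (by fun_prop)

theorem continuous_earlyTime : Continuous earlyTime :=
  continuous_projIcc.comp (by fun_prop)

@[simp] theorem lateTime_zero : lateTime 0 = 0 := Set.projIcc_of_le_left _ (by norm_num)

@[simp] theorem lateTime_one : lateTime 1 = 1 := Set.projIcc_of_right_le _ (by norm_num)

@[simp] theorem earlyTime_zero : earlyTime 0 = 0 := Set.projIcc_of_le_left _ (by norm_num)

@[simp] theorem earlyTime_one : earlyTime 1 = 1 := Set.projIcc_of_right_le _ (by norm_num)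

/-- In the homotopy below the second coordinate moves during the first half and the first coordinate
during the second half. -/
theorem earlyTime_eq_one_or (t : unitInterval) : earlyTime t = 1 ∨ lateTime t = 0 := by
  rcases le_total (1 : ℝ) (2 * t) with h | h
  · exact Or.inl (Set.projIcc_of_right_le _ h)
  · exact Or.inr (Set.projIcc_of_le_left _ (by linarith))

/-- In the second half the second coordinate has reached `p.1.2`, which is admissible for the whole
support of `p.1.1`. In the first half the first coordinate rests at `collapse p.1.1`, and both ends
of the other segment lie in the tail belonging to its support. -/
theorem segment_mem (hθ : ∀ ς σ : Simplex k, ς.1 ⊆ σ.1 → θ ς ≤ θ σ)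
    (p : XSpace θ) (t : unitInterval) :
    ∃ σ : Simplex k,
      segment (collapse p.1.1) p.1.1 (lateTime t) ∈ face σ.1 ∧
      segment (Realization.map θ (spread p.1.1)) p.1.2 (earlyTime t) ∈ tail (θ σ) := by
  rcases earlyTime_eq_one_or t with h | h
  · refine ⟨p.1.1.supp, segment_mem_face (support_collapse_subset _) (mem_face_support _) _, ?_⟩
    rw [h, segment_one]
    exact snd_mem_tail hθ p
  · refine ⟨(collapse p.1.1).supp, ?_, segment_mem_tail (map_spread_mem_tail hθ _) ?_ _⟩
    · rw [h, segment_zero]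
      exact mem_face_support _
    · exact fun s hs => (hθ _ _ (support_collapse_subset _)).trans (snd_mem_tail hθ p s hs)

theorem lift_comp_proj [Preorder k] (hθ : ∀ ς σ : Simplex k, ς.1 ⊆ σ.1 → θ ς ≤ θ σ) :
    FilterHomotopic ((lift hθ).comp (proj θ)) (ContinuousMap.id _) := by
  classical
  refine ⟨⟨fun p => ⟨(segment (collapse p.1.1.1) p.1.1.1 (lateTime p.2),
    segment (Realization.map θ (spread p.1.1.1)) p.1.1.2 (earlyTime p.2)), segment_mem hθ p.1 p.2⟩,
    continuous_prod fun c => ?_⟩, fun p => ?_, fun p => ?_, ?_⟩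
  · have hx : ∀ p : piece θ c × unitInterval, p.1.1.1.1 ∈ face c.1 := fun p => p.1.2.1
    have hc : ∀ p : piece θ c × unitInterval, collapse p.1.1.1.1 ∈ face c.1 := fun p =>
      (support_collapse_subset _).trans (hx p)
    -- The second coordinate runs from a point spanned by values of `θ` to a point of `face c.2`, so
    -- the simplex on the union of the two vertex sets contains the whole segment.
    have hm : ∀ p : piece θ c × unitInterval, Realization.map θ (spread p.1.1.1.1) ∈
        face ((subsimplices c.1).image θ ∪ c.2) := fun p =>
      (map_spread_mem_face (hx p)).trans Finset.subset_union_left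
    have hy : ∀ p : piece θ c × unitInterval, p.1.1.1.2 ∈
        face ((subsimplices c.1).image θ ∪ c.2) := fun p =>
      p.1.2.2.trans Finset.subset_union_right
    refine continuous_of_incl (c.1, (subsimplices c.1).image θ ∪ c.2)
      (fun p => ⟨segment_mem_face (hc p) (hx p) _, segment_mem_face (hm p) (hy p) _⟩) ?_
    have hi : Continuous fun p : piece θ c × unitInterval => p.1.1.1 :=
      (incl θ).continuous.comp (continuous_subtype_val.comp continuous_fst)
    have h1 := continuous_fst.comp hi
    exact (continuous_segment c.1 (continuous_collapse.comp h1) h1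
      (continuous_lateTime.comp continuous_snd) hc hx).prodMk
      (continuous_segment _ ((Realization.map θ).continuous.comp (continuous_spread.comp h1))
        (continuous_snd.comp hi) (continuous_earlyTime.comp continuous_snd) hm hy)
  · refine Subtype.ext (Prod.ext ?_ ?_)
    · exact (congrArg _ lateTime_zero).trans (segment_zero _ _)
    · exact (congrArg _ earlyTime_zero).trans (segment_zero _ _)
  · refine Subtype.ext (Prod.ext ?_ ?_)
    · exact (congrArg _ lateTime_one).trans (segment_one _ _)
    · exact (congrArg _ earlyTime_one).trans (segment_one _ _)
  · refine tendsto_iInf.2 fun j => tendsto_principal.2 ?_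
    refine mem_of_superset (preimage_mem_comap (mem_iInf_of_mem j (mem_principal_self _))) ?_
    intro p hp
    exact segment_mem_tail (fun s hs => hp s (support_collapse_subset _ hs)) hp _

end XSpace

/-! ### Monotone functions on simplices -/

theorem exists_monotone_ge {k n : Type u} [Preorder n] [Nonempty n] [IsDirectedOrder n]
    (g : Simplex k → n) :
    ∃ θ : Simplex k → n, (∀ ς σ : Simplex k, ς.1 ⊆ σ.1 → θ ς ≤ θ σ) ∧ ∀ σ, g σ ≤ θ σ := by
  classical
  choose ub hub using fun s : Finset n => s.exists_le
  -- The value at `s` is an upper bound of `g s` and of all values at proper subsets. The empty set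
  -- receives a value too, merely to let the recursion run over all finite sets.
  let step : ∀ s : Finset k, (∀ t ⊂ s, n) → n := fun s ih =>
    ub ((if h : s.Nonempty then {g ⟨s, h⟩} else ∅) ∪
      s.ssubsets.attach.image fun t => ih t.1 (Finset.mem_ssubsets.1 t.2))
  let F : Finset k → n := Finset.strongInduction step
  have hF : ∀ s, F s = step s fun t _ => F t := Finset.strongInduction_eq step
  refine ⟨fun σ => F σ.1, fun ς σ h => ?_, fun σ => ?_⟩
  · rcases h.eq_or_ssubset with h | h
    · exact (congrArg F h).le
    · refine (hub _ _ (Finset.mem_union_right _ ?_)).trans_eq (hF σ.1).symm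
      exact Finset.mem_image.2 ⟨⟨ς.1, Finset.mem_ssubsets.2 h⟩, Finset.mem_attach _ _, rfl⟩
  · refine (hub _ _ (Finset.mem_union_left _ ?_)).trans_eq (hF σ.1).symm
    rw [dif_pos σ.2]
    exact Finset.mem_singleton_self _

/-- Choices of `(θ, I)` exist. -/
theorem nonempty_reparam (m n : Type u) [Preorder m] [Preorder n] [Nonempty n]
    [IsDirectedOrder n] : Nonempty (Reparam m n) := by
  classical
  -- `g σ` bounds the finitely many values `ξ(μ(σ))` with `(i, ξ) ∈ σ`; any monotone function above
  -- `g` is then admissible.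
  choose g hg using fun σ : Simplex (Sharp m n) =>
    (σ.1.image fun p => p.2 (σ.map Prod.fst)).exists_le
  obtain ⟨θ, hmono, hge⟩ := exists_monotone_ge g
  exact ⟨{
    θ := θ
    admissible := ⟨hmono, fun σ p hp => (hg σ _ (Finset.mem_image_of_mem _ hp)).trans (hge σ)⟩
    I := XSpace.lift hmono
    proper := XSpace.tendsto_lift hmono
    proj_comp := XSpace.proj_comp_lift hmono
    comp_proj := XSpace.lift_comp_proj hmono }⟩

/-! ### Pullbacks of homotopy classes -/

section Pull

variable {G : Type v} [Group G] {X Y Z : Type*} [TopologicalSpace X] [FilterSpace X]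
  [TopologicalSpace Y] [FilterSpace Y] [TopologicalSpace Z] [FilterSpace Z]
  {A B : Type*} [NonUnitalCStarAlgebra A] [GradedGAlg G A]
  [NonUnitalCStarAlgebra B] [GradedGAlg G B]

/-- The pullback `C_b(Y; B) → C_b(X; C([0,1]; B))` along a homotopy. -/
def cbHomotopy (h : C(X × unitInterval, Y)) :
    GHom G (Y →ᵇ B) (X →ᵇ (unitInterval →ᵇ B)) where
  toFun f := BoundedContinuousFunction.ofNormedAddCommGroup
    (fun x => (BoundedContinuousFunction.mkOfCompact ⟨fun t => f (h (x, t)), by fun_prop⟩ :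
      unitInterval →ᵇ B))
    ((ContinuousMap.isometryEquivBoundedOfCompact unitInterval B).continuous.comp
      (ContinuousMap.curry (f.toContinuousMap.comp h)).continuous) ‖f‖
    (fun x => (BoundedContinuousFunction.norm_le (norm_nonneg f)).2 fun t =>
      f.norm_coe_le_norm (h (x, t)))
  map_smul' _ _ := rfl
  map_zero' := rfl
  map_add' _ _ := rfl
  map_mul' _ _ := rfl
  map_star' _ := rfl
  map_act _ _ := rfl
  map_grading _ := rfl

/-- Sets in the filter of `X × [0,1]` contain some `U × [0,1]`, so the decay along the homotopy is
uniform in `t`. The bound `ε / 2` keeps the supremum over `t` strictly below `ε`. -/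
theorem cbHomotopy_mem {h : C(X × unitInterval, Y)}
    (hh : Tendsto h (comap Prod.fst (FilterSpace.filt (X := X))) (FilterSpace.filt (X := Y)))
    {f : Y →ᵇ B} (hf : f ∈ C0 Y B) : cbHomotopy (G := G) h f ∈ C0 X (unitInterval →ᵇ B) := by
  rw [mem_C0_iff] at hf ⊢
  intro ε hε
  obtain ⟨U, hU, hUf⟩ := mem_comap.1 (hh (hf (ε / 2) (half_pos hε)))
  filter_upwards [hU] with x hx
  refine lt_of_le_of_lt ((BoundedContinuousFunction.norm_le (half_pos hε).le).2 fun t => ?_)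
    (half_lt_self hε)
  exact (hUf (show (x, t) ∈ Prod.fst ⁻¹' U from hx)).le

/-- Filter-homotopic maps induce the same map on homotopy classes. -/
theorem Cls.pull_eq_of_filterHomotopic {p₀ p₁ : C(X, Y)} (h : FilterHomotopic p₀ p₁)
    (hp₀ : Tendsto p₀ (FilterSpace.filt (X := X)) (FilterSpace.filt (X := Y)))
    (hp₁ : Tendsto p₁ (FilterSpace.filt (X := X)) (FilterSpace.filt (X := Y)))
    (z : Cls G Y A B) : Cls.pull p₀ hp₀ z = Cls.pull p₁ hp₁ z := by
  obtain ⟨h, h0, h1, hh⟩ := h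
  obtain ⟨φ, rfl⟩ := Quot.exists_rep z
  -- `H` is the pullback along the whole homotopy; evaluation at `t` recovers the pullback along its
  -- stage at `t`.
  let H : GHom G (Ca Y B) (Ca X (unitInterval →ᵇ B)) :=
    GHom.descend (Ca.mk Y) Ca.mk_surj ((Ca.mk X).comp (cbHomotopy h)) fun f hf =>
      (Ca.mk_eq_zero (G := G)).2 (cbHomotopy_mem (G := G) hh ((Ca.mk_eq_zero (G := G)).1 hf))
  have hH : ∀ (t : unitInterval) (p : C(X, Y)) (hp : Tendsto p _ _), (∀ x, h (x, t) = p x) →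
      (Ca.map X (ev t)).comp H = Ca.pull p hp := by
    intro t p hp hpt
    refine Ca.hom_ext fun f => ?_
    have : H (Ca.mk (G := G) Y f) = Ca.mk (G := G) X (cbHomotopy (G := G) h f) :=
      GHom.descend_apply _ _ _ _ f
    rw [GHom.comp_apply, this, Ca.map_mk, Ca.pull_mk]
    congr 1
    ext x
    exact congrArg f (hpt x)
  refine Quot.sound ⟨H.comp φ, ?_, ?_⟩
  · rw [← GHom.comp_assoc, hH 0 p₀ hp₀ h0]
  · rw [← GHom.comp_assoc, hH 1 p₁ hp₁ h1]

theorem Ca.pull_comp_pull (p : C(X, Y)) (q : C(Y, Z))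
    (hp : Tendsto p (FilterSpace.filt (X := X)) (FilterSpace.filt (X := Y)))
    (hq : Tendsto q (FilterSpace.filt (X := Y)) (FilterSpace.filt (X := Z))) :
    (Ca.pull (G := G) (B := B) p hp).comp (Ca.pull q hq) = Ca.pull (q.comp p) (hq.comp hp) := by
  refine Ca.hom_ext fun f => ?_
  simp only [GHom.comp_apply, Ca.pull_mk]
  rfl

theorem Cls.pull_pull (p : C(X, Y)) (q : C(Y, Z))
    (hp : Tendsto p (FilterSpace.filt (X := X)) (FilterSpace.filt (X := Y)))
    (hq : Tendsto q (FilterSpace.filt (X := Y)) (FilterSpace.filt (X := Z))) (z : Cls G Z A B) :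
    Cls.pull p hp (Cls.pull q hq z) = Cls.pull (q.comp p) (hq.comp hp) z := by
  obtain ⟨φ, rfl⟩ := Quot.exists_rep z
  exact congrArg (fun χ : GHom G (Ca Z B) (Ca X B) => Cls.mk (χ.comp φ))
    (Ca.pull_comp_pull p q hp hq)

theorem tendsto_continuousMap_id :
    Tendsto (ContinuousMap.id X) (FilterSpace.filt (X := X)) (FilterSpace.filt (X := X)) :=
  tendsto_id

theorem Cls.pull_id (z : Cls G X A B) :
    Cls.pull (ContinuousMap.id X) tendsto_continuousMap_id z = z := by
  obtain ⟨φ, rfl⟩ := Quot.exists_rep z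
  have : Ca.pull (G := G) (B := B) (ContinuousMap.id X) tendsto_continuousMap_id =
      ⟨NonUnitalStarAlgHom.id ℂ _, fun _ _ => rfl, fun _ => rfl⟩ :=
    Ca.hom_ext fun f => Ca.pull_mk _ _ f
  exact congrArg (fun χ : GHom G (Ca X B) (Ca X B) => Cls.mk (χ.comp φ)) this

end Pull

theorem Cofinal.id {m : Type u} [Preorder m] : Cofinal (_root_.id : m → m) :=
  fun j => ⟨j, fun _ h => h⟩

theorem DirCls.pull_id {G : Type v} [Group G] {A B : Type u} [NonUnitalCStarAlgebra A]
    [GradedGAlg G A] [NonUnitalCStarAlgebra B] [GradedGAlg G B] {m : Type u} [Preorder m]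
    (x : DirCls G A B m) : DirCls.pull _root_.id Cofinal.id x = x := by
  have : Realization.map (_root_.id : m → m) = ContinuousMap.id _ :=
    ContinuousMap.ext fun x => Convexity.StdSimplex.map_id x
  unfold DirCls.pull
  simp only [this]
  exact Cls.pull_id x

theorem Realization.map_map {S T U : Type u} (α : S → T) (β : T → U) (x : Realization S) :
    Realization.map β (Realization.map α x) = Realization.map (β ∘ α) x :=
  Convexity.StdSimplex.map_map _ _ _

/-! ### Functoriality of the spaces `X_θ` -/

namespace XSpace

variable {k n k' n' : Type u} [Preorder n] [Preorder n'] {θ : Simplex k → n}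
  {θ' : Simplex k' → n'}

/-- The map `|δ| × |β| : X_θ → X_θ'`. -/
def map (δ : k → k') (β : n → n') (h : ∀ σ j, θ σ ≤ j → θ' (σ.map δ) ≤ β j) :
    C(XSpace θ, XSpace θ') where
  toFun p := ⟨(Realization.map δ p.1.1, Realization.map β p.1.2), by
    classical
    obtain ⟨σ, hx, hy⟩ := p.2
    refine ⟨σ.map δ, ?_, fun t ht => ?_⟩
    · intro t ht
      obtain ⟨s, hs, rfl⟩ := Realization.support_map δ _ ht
      exact Finset.mem_image.2 ⟨s, hx hs, rfl⟩
    · obtain ⟨s, hs, rfl⟩ := Realization.support_map β _ ht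
      exact h _ _ (hy s hs)⟩
  continuous_toFun := by
    classical
    refine continuous_of_piece fun c => continuous_of_incl (c.1.image δ, c.2.image β)
      (fun p => ⟨Realization.map_mem_face δ p.2.1, Realization.map_mem_face β p.2.2⟩) ?_
    exact ((Realization.map δ).prodMap (Realization.map β)).continuous.comp
      ((incl θ).continuous.comp continuous_subtype_val)

theorem tendsto_map [Preorder k] [Preorder k'] {δ : k → k'} {β : n → n'}
    (h : ∀ σ j, θ σ ≤ j → θ' (σ.map δ) ≤ β j) (hδ : Cofinal δ) :
    Tendsto (map δ β h) (FilterSpace.filt (X := XSpace θ)) (FilterSpace.filt (X := XSpace θ')) := by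
  refine tendsto_iInf.2 fun j => tendsto_principal.2 ?_
  obtain ⟨i, hi⟩ := hδ j
  refine mem_of_superset (mem_iInf_of_mem i (mem_principal_self _)) fun p hp t ht => ?_
  obtain ⟨s, hs, rfl⟩ := Realization.support_map δ _ ht
  exact hi s (hp s hs)

end XSpace

/-! ### Compatibility of the composition product with cofinal maps -/

section Product

variable {G : Type v} [Group G] {A B C : Type u}
  [NonUnitalCStarAlgebra A] [GradedGAlg G A] [NonUnitalCStarAlgebra B] [GradedGAlg G B]
  [NonUnitalCStarAlgebra C] [GradedGAlg G C]
  {m n m' n' k : Type u} [Preorder m] [Preorder n] [Preorder m'] [Preorder n'] [Preorder k]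

/-- Every pullback along a map to `X_θ` can be computed through `|Δ^{m ♯ n}|`. -/
theorem Reparam.pull_eq (R : Reparam m n) {Z : Type*} [TopologicalSpace Z] [FilterSpace Z]
    (J : C(Z, XSpace R.θ))
    (hJ : Tendsto J (FilterSpace.filt (X := Z)) (FilterSpace.filt (X := XSpace R.θ)))
    (z : Cls G (XSpace R.θ) A C) :
    Cls.pull J hJ z = Cls.pull ((XSpace.proj R.θ).comp J) ((XSpace.tendsto_proj R.θ).comp hJ)
      (Cls.pull R.I R.proper z) := by
  rw [← Cls.pull_pull J (XSpace.proj R.θ) hJ (XSpace.tendsto_proj R.θ),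
    Cls.pull_pull (XSpace.proj R.θ) R.I (XSpace.tendsto_proj R.θ) R.proper,
    Cls.pull_eq_of_filterHomotopic R.comp_proj _ tendsto_continuousMap_id, Cls.pull_id]

variable [Nonempty m] [IsDirectedOrder m] [Nonempty n] [IsDirectedOrder n]
  [Nonempty m'] [IsDirectedOrder m'] [Nonempty n'] [IsDirectedOrder n']

/-- On a representative `f` in `C_b(|Δ^m|; C_b(|Δ^n|; C))`, both sides are pullback along one and
the same map `X_κ → |Δ^m| × |Δ^n|`, because `μ ∘ δ = α ∘ μ ∘ γ`. The equality holds for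
homomorphisms, not only up to homotopy. -/
theorem pull_map_comp_muStar {θ : Simplex (Sharp m n) → n} (hθ : Admissible θ)
    {θ' : Simplex (Sharp m' n') → n'} (hθ' : Admissible θ') {κ : Simplex k → n'}
    {α : m' → m} (hα : Cofinal α) {β : n' → n} (hβ : Cofinal β)
    {δ : k → Sharp m n} (hδ : Cofinal δ) {γ : k → Sharp m' n'} (hγ : Cofinal γ)
    (hcomm : ∀ i, (δ i).1 = α (γ i).1) (h₁ : ∀ σ j, κ σ ≤ j → θ (σ.map δ) ≤ β j)
    (h₂ : ∀ σ j, κ σ ≤ j → θ' (σ.map γ) ≤ _root_.id j) :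
    (Ca.pull (XSpace.map δ β h₁) (XSpace.tendsto_map h₁ hδ)).comp (muStar G C hθ) =
      ((Ca.pull (XSpace.map γ _root_.id h₂) (XSpace.tendsto_map h₂ hγ)).comp
        (muStar G C hθ')).comp
        ((Ca.map (Realization m') (Ca.pull (Realization.map β) hβ.tendsto)).comp
          (Ca.pull (Realization.map α) hα.tendsto)) := by
  refine GHom.ext fun a => ?_
  obtain ⟨f, rfl⟩ := mk_comp_cbMap_mk_surj (G := G) a
  -- The restriction of `f` along `|α| × |β|` represents the image of its class in `C_a(|Δ^m'|;
  -- C_a(|Δ^n'|; C))`.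
  let f' : Realization m' →ᵇ (Realization n' →ᵇ C) := cbMap (Realization m')
    (cbPull (G := G) (Realization.map β)) (cbPull (G := G) (Realization.map α) f)
  have hf' : cbMap (Realization m') (Ca.pull (G := G) (Realization.map β) hβ.tendsto)
      (cbPull (G := G) (Realization.map α)
        (cbMap (Realization m) (Ca.mk (G := G) (Realization n)) f)) =
      cbMap (Realization m') (Ca.mk (G := G) (Realization n')) f' := by
    ext x
    exact Ca.pull_mk _ hβ.tendsto (f (Realization.map α x))
  simp only [GHom.comp_apply, muStar_mk, Ca.pull_mk, Ca.map_mk, hf']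
  congr 1
  ext p
  change f (Realization.map Prod.fst (Realization.map δ p.1.1)) (Realization.map β p.1.2) =
    f (Realization.map α (Realization.map Prod.fst (Realization.map γ p.1.1)))
      (Realization.map β (Realization.map _root_.id p.1.2))
  have e1 : Realization.map Prod.fst (Realization.map δ p.1.1) =
      Realization.map α (Realization.map Prod.fst (Realization.map γ p.1.1)) := by
    have : (Prod.fst ∘ δ) = α ∘ Prod.fst ∘ γ := funext hcomm
    rw [Realization.map_map, Realization.map_map, Realization.map_map, this]
    rfl
  have e2 : Realization.map _root_.id p.1.2 = p.1.2 := Convexity.StdSimplex.map_id _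
  rw [e1, e2]

/-- Both products are compared on a third space `X_κ` mapping to `X_θ` and `X_θ'`. Only monotonicity
of `κ` is needed, which is why `k` can be any preorder with suitable maps `δ` and `γ`. -/
theorem Reparam.pull_compProd (R : Reparam m n) (R' : Reparam m' n')
    {α : m' → m} (hα : Cofinal α) {β : n' → n} (hβ : Cofinal β)
    {δ : k → Sharp m n} (hδ : Cofinal δ) {γ : k → Sharp m' n'} (hγ : Cofinal γ)
    (hcomm : ∀ i, (δ i).1 = α (γ i).1) (x : DirCls G A B m) (y : DirCls G B C n) :
    DirCls.pull δ hδ (R.compProd x y) =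
      DirCls.pull γ hγ (R'.compProd (DirCls.pull α hα x) (DirCls.pull β hβ y)) := by
  obtain ⟨φ, rfl⟩ := Quot.exists_rep x
  obtain ⟨ψ, rfl⟩ := Quot.exists_rep y
  -- By cofinality of `β`, every `j ≥ g σ` satisfies `β j ≥ θ(δ(σ))`. Taking `κ` above both `g σ`
  -- and `θ'(γ(σ))` makes the two maps out of `X_κ` well defined.
  choose g hg using fun σ : Simplex k => hβ (R.θ (σ.map δ))
  choose g' hg₁ hg₂ using fun σ : Simplex k => exists_ge_ge (g σ) (R'.θ (σ.map γ))
  obtain ⟨κ, hκ, hκ'⟩ := exists_monotone_ge g'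
  have h₁ : ∀ σ j, κ σ ≤ j → R.θ (σ.map δ) ≤ β j := fun σ j hj =>
    hg σ j ((hg₁ σ).trans ((hκ' σ).trans hj))
  have h₂ : ∀ σ j, κ σ ≤ j → R'.θ (σ.map γ) ≤ _root_.id j := fun σ j hj =>
    (hg₂ σ).trans ((hκ' σ).trans hj)
  -- `z` and `z'` are the two products before pulling back along `R.I` and `R'.I`.
  let z : Cls G (XSpace R.θ) A C :=
    Cls.mk ((muStar G C R.admissible).comp ((Ca.map (Realization m) ψ).comp φ))
  let z' : Cls G (XSpace R'.θ) A C :=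
    Cls.mk ((muStar G C R'.admissible).comp
      ((Ca.map (Realization m') ((Ca.pull (Realization.map β) hβ.tendsto).comp ψ)).comp
        ((Ca.pull (Realization.map α) hα.tendsto).comp φ)))
  have hz : Cls.pull (XSpace.map δ β h₁) (XSpace.tendsto_map h₁ hδ) z =
      Cls.pull (XSpace.map γ _root_.id h₂) (XSpace.tendsto_map h₂ hγ) z' := by
    refine congrArg (Quot.mk _) ?_
    beta_reduce
    rw [← GHom.comp_assoc, pull_map_comp_muStar R.admissible R'.admissible hα hβ hδ hγ hcomm h₁ h₂,
      Ca.map_map]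
    simp only [GHom.comp_assoc]
    rw [← GHom.comp_assoc (Ca.map (Realization m') ψ), Ca.map_comp_pull]
    rfl
  -- Pullback along the projection of `X_κ` is injective on classes, since that projection has a
  -- section up to homotopy.
  have key : ∀ {w : Cls G (Realization k) A C} {w' : Cls G (Realization k) A C},
      Cls.pull (XSpace.proj κ) (XSpace.tendsto_proj κ) w =
        Cls.pull (XSpace.proj κ) (XSpace.tendsto_proj κ) w' → w = w' := by
    intro w w' h
    have h' := congrArg (Cls.pull (XSpace.lift hκ) (XSpace.tendsto_lift hκ)) h
    simpa only [Cls.pull_pull, Cls.pull_eq_of_filterHomotopic (XSpace.proj_comp_lift hκ) _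
      tendsto_continuousMap_id, Cls.pull_id] using h'
  change Cls.pull (Realization.map δ) hδ.tendsto (Cls.pull R.I R.proper z) =
    Cls.pull (Realization.map γ) hγ.tendsto (Cls.pull R'.I R'.proper z')
  refine key ?_
  rw [Cls.pull_pull (XSpace.proj κ), Cls.pull_pull (XSpace.proj κ)]
  -- The projections intertwine `|δ| × |β|` with `|δ|` and `|γ| × id` with `|γ|`, by definition; so
  -- after this rewriting `hz` is the goal.
  rw [R.pull_eq, R'.pull_eq] at hz
  exact hz

end Product

/-! ### The composition product on direct limits -/

section

variable {m n m' n' : Type u} [Preorder m] [Preorder n] [Preorder m'] [Preorder n']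

/-- Cofinality of `β` is applied separately to each value `j.2 ρ`; the resulting thresholds form the
function `ξ`. -/
theorem Cofinal.sharp (m : Type u) [Preorder m] [Nonempty m] {β : n' → n} (hβ : Cofinal β) :
    Cofinal (fun p : Sharp m n' => ((p.1, β ∘ p.2) : Sharp m n)) := fun j => by
  choose ξ hξ using fun ρ => hβ (j.2 ρ)
  exact ⟨(j.1, ξ), fun k hk => ⟨hk.1, fun ρ => hξ ρ _ (hk.2 ρ)⟩⟩

theorem Cofinal.prod_fst {m : Type u} [Nonempty n] :
    Cofinal (fun p : m' × (Simplex m' → n) × (Simplex m → n) => ((p.1, p.2.1) : Sharp m' n)) :=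
  fun j => ⟨(j.1, j.2, fun _ => Classical.arbitrary n), fun _ hk => ⟨hk.1, hk.2.1⟩⟩

theorem Cofinal.prod_snd [Nonempty n] {α : m' → m} (hα : Cofinal α) :
    Cofinal (fun p : m' × (Simplex m' → n) × (Simplex m → n) => ((α p.1, p.2.2) : Sharp m n)) :=
  fun j => by
    obtain ⟨i, hi⟩ := hα j.1
    exact ⟨(i, fun _ => Classical.arbitrary n, j.2), fun k hk => ⟨hi _ hk.1, hk.2.2⟩⟩

end

/-! ### Well-definedness on the direct limit -/

section

variable {G : Type v} [Group G] {A B C : Type u}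
  [NonUnitalCStarAlgebra A] [GradedGAlg G A] [NonUnitalCStarAlgebra B] [GradedGAlg G B]
  [NonUnitalCStarAlgebra C] [GradedGAlg G C]

theorem SimplMor.of_pull {m m' : DirSet.{u}} (α : m' → m) (hα : Cofinal α) (x : DirCls G A B m) :
    SimplMor.of m' (DirCls.pull α hα x) = SimplMor.of m x :=
  (Quot.sound ⟨α, hα, rfl⟩ : SimplMor.of m x = _).symm

/-- The directed set `m' × n^{Δ^{m'}} × n^{Δ^m}`. -/
def DirSet.sharp₂ (m m' n : DirSet.{u}) : DirSet.{u} :=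
  letI := directed_pi (Simplex m) n
  letI := directed_pi (Simplex m') n
  letI := directed_prod (Simplex m' → n) (Simplex m → n)
  letI := directed_prod m' ((Simplex m' → n) × (Simplex m → n))
  ⟨m' × (Simplex m' → n) × (Simplex m → n)⟩

/-- The general comparison with all four cofinal maps equal to the identity. -/
theorem Reparam.compProd_eq {m n : DirSet.{u}} (R R' : Reparam m n) (x : DirCls G A B m)
    (y : DirCls G B C n) : R.compProd x y = R'.compProd x y := by
  have h := R.pull_compProd R' Cofinal.id Cofinal.id (Cofinal.id (m := Sharp m n)) Cofinal.id
    (fun _ => rfl) x y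
  simpa only [DirCls.pull_id] using h

theorem Reparam.pull_compProd_right {m n n' : DirSet.{u}} {β : n' → n} (hβ : Cofinal β)
    (R : Reparam m n) (R' : Reparam m n') (x : DirCls G A B m) (y : DirCls G B C n) :
    DirCls.pull _ (hβ.sharp m) (R.compProd x y) = R'.compProd x (DirCls.pull β hβ y) := by
  have h := R.pull_compProd R' Cofinal.id hβ (hβ.sharp m) (Cofinal.id (m := Sharp m n'))
    (fun _ => rfl) x y
  simpa only [DirCls.pull_id] using h

/-- A map `α` of vertices gives no evident map between `m' ♯ n` and `m ♯ n`, as functions on `Δ^m`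
pull back to `Δ^{m'}` while `α` itself points the other way. Hence both function spaces are carried
along as factors of the common source. -/
theorem Reparam.pull_compProd_left {m m' n : DirSet.{u}} {α : m' → m} (hα : Cofinal α)
    (R : Reparam m n) (R' : Reparam m' n) (x : DirCls G A B m) (y : DirCls G B C n) :
    DirCls.pull _ (hα.prod_snd (n := n)) (R.compProd x y) =
      DirCls.pull _ (Cofinal.prod_fst (m := m)) (R'.compProd (DirCls.pull α hα x) y) := by
  have h := R.pull_compProd R' hα Cofinal.id (hα.prod_snd (n := n)) (Cofinal.prod_fst (m := m))
    (fun _ => rfl) x y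
  simpa only [DirCls.pull_id] using h

theorem SimplMor.of_compProd_right {m n n' : DirSet.{u}} {β : n' → n} (hβ : Cofinal β)
    (R : Reparam m n) (R' : Reparam m n') (x : DirCls G A B m) (y : DirCls G B C n) :
    SimplMor.of (m.sharp n) (R.compProd x y) =
      SimplMor.of (m.sharp n') (R'.compProd x (DirCls.pull β hβ y)) := by
  rw [← R.pull_compProd_right hβ R']
  exact (SimplMor.of_pull (m := m.sharp n) (m' := m.sharp n') _ (hβ.sharp m) _).symm

theorem SimplMor.of_compProd_left {m m' n : DirSet.{u}} {α : m' → m} (hα : Cofinal α)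
    (R : Reparam m n) (R' : Reparam m' n) (x : DirCls G A B m) (y : DirCls G B C n) :
    SimplMor.of (m.sharp n) (R.compProd x y) =
      SimplMor.of (m'.sharp n) (R'.compProd (DirCls.pull α hα x) y) :=
  calc _ = SimplMor.of (DirSet.sharp₂ m m' n) (DirCls.pull _ (hα.prod_snd (n := n))
          (R.compProd x y)) :=
        (SimplMor.of_pull (m := m.sharp n) (m' := DirSet.sharp₂ m m' n) _ hα.prod_snd _).symm
    _ = SimplMor.of (DirSet.sharp₂ m m' n) (DirCls.pull _ (Cofinal.prod_fst (m := m))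
          (R'.compProd (DirCls.pull α hα x) y)) :=
        congrArg _ (R.pull_compProd_left hα R' x y)
    _ = _ := SimplMor.of_pull (m := m'.sharp n) (m' := DirSet.sharp₂ m m' n) _ Cofinal.prod_fst _

/-- The composition product on direct limits. -/
def SimplMor.comp : SimplMor G A B → SimplMor G B C → SimplMor G A C :=
  Quot.lift₂ (fun x y => SimplMor.of (x.1.sharp y.1)
      ((nonempty_reparam x.1 y.1).some.compProd x.2 y.2))
    (by
      -- The arbitrarily chosen reparametrizations for `n` and `n'` are unrelated; the comparison
      -- allows any pair of them.
      rintro ⟨m, x⟩ ⟨n, y⟩ ⟨n', y'⟩ ⟨β, hβ, h⟩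
      exact (SimplMor.of_compProd_right (n := n) (n' := n') hβ _ _ x y).trans
        (congrArg (fun z => SimplMor.of (m.sharp n') (Reparam.compProd _ x z)) h.symm))
    (by
      rintro ⟨m, x⟩ ⟨m', x'⟩ ⟨n, y⟩ ⟨α, hα, h⟩
      exact (SimplMor.of_compProd_left (m := m) (m' := m') hα _ _ x y).trans
        (congrArg (fun z => SimplMor.of (m'.sharp n) (Reparam.compProd _ z y)) h.symm))

theorem SimplMor.comp_of {m n : DirSet.{u}} (R : Reparam m n) (x : DirCls G A B m)
    (y : DirCls G B C n) :
    SimplMor.comp (SimplMor.of m x) (SimplMor.of n y) =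
      SimplMor.of (m.sharp n) (R.compProd x y) :=
  congrArg (SimplMor.of (m.sharp n)) (Reparam.compProd_eq _ R x y)

end

end

end Simpltotic

theorem mainTheorem4 {G : Type v} [Group G] {A B C : Type u}
    [NonUnitalCStarAlgebra A] [GradedGAlg G A] [NonUnitalCStarAlgebra B] [GradedGAlg G B]
    [NonUnitalCStarAlgebra C] [GradedGAlg G C] :
    -- the composition product is defined, independently of all choices
    (∀ m n : DirSet.{u}, Nonempty (Reparam m n) ∧
      ∀ (R R' : Reparam m n) (x : DirCls G A B m) (y : DirCls G B C n),
        R.compProd x y = R'.compProd x y) ∧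
    -- compatibility with cofinal maps in the second variable
    (∀ (m n n' : DirSet.{u}) (β : n' → n) (hβ : Cofinal β),
      ∃ h : Cofinal (fun p : Sharp m n' => ((p.1, β ∘ p.2) : Sharp m n)),
        ∀ (R : Reparam m n) (R' : Reparam m n') (x : DirCls G A B m) (y : DirCls G B C n),
          DirCls.pull _ h (R.compProd x y) = R'.compProd x (DirCls.pull β hβ y)) ∧
    -- compatibility with cofinal maps in the first variable
    (∀ (m m' n : DirSet.{u}) (α : m' → m) (hα : Cofinal α),
      Nonempty (m' × (Simplex m' → n) × (Simplex m → n)) ∧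
      IsDirectedOrder (m' × (Simplex m' → n) × (Simplex m → n)) ∧
      ∃ (hγ : Cofinal (fun p : m' × (Simplex m' → n) × (Simplex m → n) =>
          ((p.1, p.2.1) : Sharp m' n)))
        (hδ : Cofinal (fun p : m' × (Simplex m' → n) × (Simplex m → n) =>
          ((α p.1, p.2.2) : Sharp m n))),
        ∀ (R : Reparam m n) (R' : Reparam m' n) (x : DirCls G A B m) (y : DirCls G B C n),
          DirCls.pull _ hδ (R.compProd x y) =
            DirCls.pull _ hγ (R'.compProd (DirCls.pull α hα x) y)) ∧
    -- the composition product passes to the direct limits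
    (∃! c : SimplMor G A B → SimplMor G B C → SimplMor G A C,
      ∀ (m n : DirSet.{u}) (R : Reparam m n) (x : DirCls G A B m) (y : DirCls G B C n),
        c (SimplMor.of m x) (SimplMor.of n y) = SimplMor.of (m.sharp n) (R.compProd x y)) := by
  refine ⟨fun m n => ⟨nonempty_reparam m n, fun R R' => R.compProd_eq R'⟩,
    fun m n n' β hβ => ⟨hβ.sharp m, fun R R' => R.pull_compProd_right hβ R'⟩,
    fun m m' n α hα => ⟨(DirSet.sharp₂ m m' n).nonempty, (DirSet.sharp₂ m m' n).directed,
      Cofinal.prod_fst, hα.prod_snd, fun R R' => R.pull_compProd_left hα R'⟩,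
    SimplMor.comp, fun m n R => SimplMor.comp_of R, fun c hc => ?_⟩
  funext x y
  -- Uniqueness: every element of the limit comes from some directed set, and a reparametrization
  -- exists for each pair, so the prescribed values determine `c` everywhere.
  obtain ⟨⟨m, x⟩, rfl⟩ := Quot.exists_rep x
  obtain ⟨⟨n, y⟩, rfl⟩ := Quot.exists_rep y
  obtain ⟨R⟩ := nonempty_reparam m n
  exact (hc m n R x y).trans (SimplMor.comp_of R x y).symm
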